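/- For $x,q\in\mathbb C$ put $(x;q)_0=1$ and $(x;q)_k=\prod_{r=0}^{k-1}(1-xq^r)$ for $k\ge 1$, and write \[\left[\begin{matrix}x_1,\dots,x_s\\ y_1,\dots,y_t\end{matrix};q\right]_k=\frac{(x_1;q)_k\cdots(x_s;q)_k}{(y_1;q)_k\cdots(y_t;q)_k},\qquad {}_4\phi_3\left[\begin{matrix}a_0,a_1,a_2,a_3\\ b_1,b_2,b_3\end{matrix};q,z\right]=\sum_{k=0}^{\infty}\left[\begin{matrix}a_0,a_1,a_2,a_3\\ q,b_1,b_2,b_3\end{matrix};q\right]_k z^k .\] Let $\ell,m,n$ be nonnegative integers with $m\le n$, and let $q,a,c$ be nonzero complex numbers such that no denominator occurring in the identity below vanishes (on the left-hand side, in the summands with $0\le k\le n$; the summands with $k>n$ are zero because of the factor $(q^{-n};q)_k$). Then the series on the left converges and \[{}_4\phi_3\left[\begin{matrix}a,\;q^{1+\ell}/a,\;q^{-n},\;-q^{m-n}\\ c,\;q^{1+\ell+m-2n}/c,\;-q\end{matrix};q,q\right] =\left[\begin{matrix}q^{2}/(ac),\;-q/a\\ q^{2}/a^2,\;-q/c\end{matrix};q\right]_{\ell}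 \left[\begin{matrix}q^{1-m+n},\;-q^{-\ell}c\\ q^{n-m-\ell}c,\;-q\end{matrix};q\right]_{n}\] \[\times\sum_{i=0}^{\ell}\sum_{j=0}^{m}q^{(\ell+1)i+(m-n)j+\binom{j+1}{2}}\,\frac{(-1)^i}{c^i}\, \frac{1-q^{1+2i}/a^2}{1-q/a^2} \left[\begin{matrix}q^{-\ell},\;c/a,\;q/a^2\\ q,\;q^2/(ac),\;q^{2+\ell}/a^2\end{matrix};q\right]_i\] \[\times\left[\begin{matrix}q^{-m},\;q^{-n},\;-q^{-n},\;q^{-i-1}ac,\;q^{i}c/a\\ q,\;c,\;-c,\;q^{m-2n},\;q^{j-2n-1}\end{matrix};q\right]_j \left[\begin{matrix}q^{j-i}ac,\;q^{1+i+j}c/a\\ q,\;q^{2j}c^2\end{matrix};q^2\right]_{n-j}.\] -/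

import Mathlib

/-- The `q`-shifted factorial `(x; q)_n`, the product of `1 - x * q ^ k` over `0 ≤ k < n`. -/
noncomputable def qPoch (x q : ℂ) (n : ℕ) : ℂ :=
  ∏ k ∈ Finset.range n, (1 - x * q ^ k)

/-- The fraction form of `q`-shifted factorials with base `q`: the product of `(x; q)_n` over the
entries `x` of `num`, divided by the product of `(y; q)_n` over the entries `y` of `den`. -/
noncomputable def qFrac (q : ℂ) (num den : List ℂ) (n : ℕ) : ℂ :=
  (num.map fun x => qPoch x q n).prod / (den.map fun y => qPoch y q n).prod

/-- The `k`-th summand of the basic hypergeometric series with base `q`, argument `z`, upper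
parameters `num` and lower parameters `den` (one fewer of them; the factor `(q; q)_k` of the
denominator is not listed in `den`). -/
noncomputable def basicHypTerm (q z : ℂ) (num den : List ℂ) (k : ℕ) : ℂ :=
  qFrac q num (q :: den) k * z ^ k

/-- The basic hypergeometric series `φ` with base `q`, argument `z`, upper parameters `num` and
lower parameters `den`. -/
noncomputable def basicHyp (q z : ℂ) (num den : List ℂ) : ℂ :=
  ∑' k : ℕ, basicHypTerm q z num den k

/-! The proof is by contiguous relations between balanced `₄φ₃` series, followed by a density
argument. Write `S(a, b; q ^ (-n), D; c, F)` for the series with numerator parameters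
`a, b, q ^ (-n), D` and denominator parameters `c, F, -q`; all series below are balanced, that is,
the product of the denominator parameters is `q` times the product of the numerator parameters.

*The case `ℓ = m = 0`* is Andrews' terminating `q`-analogue of Whipple's `₃F₂` sum. Replacing
`(n, c)` by `(n - 1, c * q ^ 2)` multiplies the series by an explicit factor (`whipple_step`), so
the sum follows by induction on `n` (`sum_phiTerm_whipple`).

*Raising `m`.* The three-term relation `contig_shift` expresses the series for `(m + 1, n, c)`
through those for `(m, n, c)` and `(m, n - 1, c * q)`. The products over `j` behave in the same way,
since the `j`-th product for `(n - 1, c * q)` is, up to a factor free of `j`, the `(j + 1)`-st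
product for `(n, c)` (`pairFactor_succ`), and the coefficients satisfy the matching Pascal-type
recurrence (`shiftCoeff_recurrence`). Induction on `m` gives the sum over `j`
(`sum_phiTerm_shift`).

*Raising `ℓ`.* The relation `contig_pair` expresses the series for `(ℓ + 1, a)` through those for
`(ℓ, a)` and `(ℓ, a / q)`, and the very-well-poised coefficients obey `poisedCoeff_recurrence`.
Induction on `ℓ` gives the sum over `i` of series whose first two numerator parameters are
`a * q ^ (-i)` and `q ^ (1 + i) / a` (`sum_phiTerm_pair`), to which the previous step applies.

Each of the three relations is proved by telescoping: the combination of summands is the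
difference `g (k + 1) - g k` of an explicit `g`, where `g 0 = 0` and `g` vanishes past the point of
termination. With `X = q ^ k` this is a rational identity in `X` and the parameters.

The inductions pass through parameters whose denominators the hypotheses do not control. The
identity is therefore first proved for `(q, a, c)` in a dense set (`genericSet`), and then extended:
both sides are continuous wherever the denominators of the identity itself do not vanish. -/

open Finset Filter Topology

/-! ### `q`-shifted factorials and balanced series -/

theorem qPoch_zero (x q : ℂ) : qPoch x q 0 = 1 := by simp [qPoch]

theorem qPoch_succ (x q : ℂ) (n : ℕ) : qPoch x q (n + 1) = qPoch x q n * (1 - x * q ^ n) := by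
  simp [qPoch, prod_range_succ]

theorem qPoch_succ' (x q : ℂ) (n : ℕ) : qPoch x q (n + 1) = (1 - x) * qPoch (x * q) q n := by
  simp only [qPoch, prod_range_succ', pow_zero, mul_one, pow_succ']
  rw [mul_comm]
  simp only [mul_assoc]

theorem qPoch_shift (x q : ℂ) (n : ℕ) :
    (1 - x) * qPoch (x * q) q n = qPoch x q n * (1 - x * q ^ n) := by
  rw [← qPoch_succ', qPoch_succ]

theorem qPoch_mul_base (x q : ℂ) (n : ℕ) (hx : 1 - x ≠ 0) :
    qPoch (x * q) q n = qPoch x q n * (1 - x * q ^ n) / (1 - x) := by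
  rw [eq_div_iff hx, mul_comm, qPoch_shift]

theorem qPoch_ne_zero {x q : ℂ} {n : ℕ} (h : ∀ k : ℕ, 1 - x * q ^ k ≠ 0) : qPoch x q n ≠ 0 :=
  prod_ne_zero_iff.2 fun k _ => h k

/-- The summand of a `₄φ₃` series with base and argument `q`. -/
noncomputable def phiTerm (q A B C D E F G : ℂ) (k : ℕ) : ℂ :=
  qPoch A q k * qPoch B q k * qPoch C q k * qPoch D q k /
    (qPoch q q k * qPoch E q k * qPoch F q k * qPoch G q k) * q ^ k

theorem phiTerm_succ (q A B C D E F G : ℂ) (k : ℕ) :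
    phiTerm q A B C D E F G (k + 1) = phiTerm q A B C D E F G k *
      (q * ((1 - A * q ^ k) * (1 - B * q ^ k) * (1 - C * q ^ k) * (1 - D * q ^ k)) /
        ((1 - q * q ^ k) * (1 - E * q ^ k) * (1 - F * q ^ k) * (1 - G * q ^ k))) := by
  simp only [phiTerm, qPoch_succ, pow_succ]
  rw [div_mul_eq_mul_div, div_mul_eq_mul_div, div_mul_div_comm]
  congr 1 <;> ring

/-! ### Contiguous relations for balanced `₄φ₃` series -/

/-- The rational identity behind `contig_pair`: the three summands and the telescoping function,
each divided by `phiTerm q A B C D E F G k`, with `X = q ^ k`. -/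
theorem contig_pair_rat {q A B C D E F G X : ℂ} (hq : q ≠ 0) (hX : X ≠ 0) (hA₀ : A ≠ 0)
    (hB₀ : B ≠ 0) (hE₀ : E ≠ 0) (hF₀ : F ≠ 0) (hA : 1 - A ≠ 0) (hB : 1 - B ≠ 0) (hAB : A - B ≠ 0)
    (hFC : F - C ≠ 0) (hFD : F - D ≠ 0) (hqX : 1 - q * X ≠ 0) (hE : 1 - E * X ≠ 0)
    (hF : 1 - F * X ≠ 0) (hG : 1 - G * X ≠ 0) (bal : A * B * C * D * q ^ 2 = E * F * G) :
    (1 - A * X) / (1 - A) * ((1 - B * X) / (1 - B)) * ((1 - F) / (1 - F * X)) -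
        F * (1 - F) * (q * B - E) * (q * B - G) / ((F - C) * (F - D) * (q ^ 2 * B * (A - B))) *
          ((1 - A * X) / (1 - A)) -
        F * (1 - F) * (q * A - E) * (q * A - G) / ((F - C) * (F - D) * (q ^ 2 * A * (B - A))) *
          ((1 - B * X) / (1 - B)) =
      F * (1 - F) / ((F - C) * (F - D) * ((1 - A) * (1 - B))) *
        ((q * ((1 - A * X) * (1 - B * X) * (1 - C * X) * (1 - D * X)) /
          ((1 - q * X) * (1 - E * X) * (1 - F * X) * (1 - G * X))) *
          ((1 - q * X) * (1 - E * X) * (1 - G * X) / (q * X)) -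
          (1 - X) * (1 - E * X / q) * (1 - G * X / q) / X) := by
  obtain rfl : G = A * B * C * D * q ^ 2 / (E * F) := by
    rw [bal]; field_simp
  have hE' := hE
  have hF' := hF
  rw [mul_comm] at hE' hF'
  have hBA : B - A ≠ 0 := fun h => hAB (by linear_combination -h)
  have e1 : (q * ((1 - A * X) * (1 - B * X) * (1 - C * X) * (1 - D * X)) /
          ((1 - q * X) * (1 - E * X) * (1 - F * X) * (1 - A * B * C * D * q ^ 2 / (E * F) * X))) *
          ((1 - q * X) * (1 - E * X) * (1 - A * B * C * D * q ^ 2 / (E * F) * X) / (q * X)) =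
      (1 - A * X) * (1 - B * X) * (1 - C * X) * (1 - D * X) / ((1 - F * X) * X) := by
    generalize A * B * C * D * q ^ 2 / (E * F) = G at *
    have hG' := hG
    rw [mul_comm] at hG'
    field_simp
  rw [e1]
  have : B - A = -(A - B) := by ring
  rw [this]
  clear e1 hG bal hqX
  field_simp
  ring

/-- The rational identity behind `contig_shift`, with `X = q ^ k`. -/
theorem contig_shift_rat {q A B C D E F G X : ℂ} (hq : q ≠ 0) (hX : X ≠ 0) 
    (hD₀ : D ≠ 0) (hE₀ : E ≠ 0) (hF₀ : F ≠ 0) (hC : 1 - C ≠ 0) (hD : 1 - D ≠ 0) (hE1 : 1 - E ≠ 0)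
    (hFC : F - C ≠ 0) (hF1 : 1 - F ≠ 0) (hFE : E * F - A * B ≠ 0)
    (hqX : 1 - q * X ≠ 0) (hE : 1 - E * X ≠ 0)
    (hF : 1 - F * X ≠ 0) (hG : 1 - G * X ≠ 0) (bal : A * B * C * D * q = E * F * G) :
    (1 - D * X) / (1 - D) * ((1 - F) / (1 - F * X)) -
        E * F * (1 - F) * (G - q * D) / ((F - C) * (E * F - A * B) * (q * D)) -
        (-F * (1 - C) * (E - A) * (E - B) / ((F - C) * (E * F - A * B) * (1 - E))) *
          ((1 - C * X) / (1 - C) * ((1 - D * X) / (1 - D)) * ((1 - E) / (1 - E * X)) *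
            ((1 - F) / (1 - F * X))) =
      E * F * (1 - F) / ((F - C) * (E * F - A * B) * (1 - D)) *
        ((q * ((1 - A * X) * (1 - B * X) * (1 - C * X) * (1 - D * X)) /
          ((1 - q * X) * (1 - E * X) * (1 - F * X) * (1 - G * X))) *
          ((1 - q * X) * (1 - G * X) / (q * X)) -
          (1 - X) * (1 - G * X / q) / X) := by
  obtain rfl : G = A * B * C * D * q / (E * F) := by
    rw [bal]; field_simp
  have hE' := hE
  have hF' := hF
  have hFE' := hFE
  rw [mul_comm] at hE' hF'
  rw [mul_comm E F] at hFE'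
  have e1 : (q * ((1 - A * X) * (1 - B * X) * (1 - C * X) * (1 - D * X)) /
          ((1 - q * X) * (1 - E * X) * (1 - F * X) * (1 - A * B * C * D * q / (E * F) * X))) *
          ((1 - q * X) * (1 - A * B * C * D * q / (E * F) * X) / (q * X)) =
      (1 - A * X) * (1 - B * X) * (1 - C * X) * (1 - D * X) / ((1 - E * X) * (1 - F * X) * X) := by
    generalize A * B * C * D * q / (E * F) = G at *
    have hG' := hG
    rw [mul_comm] at hG'
    field_simp
  rw [e1]
  clear e1 hG bal hqX
  field_simp
  ring

/-- The rational identity behind `whipple_step`, with `X = q ^ k`. -/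
theorem whipple_rat {q A B C E F X : ℂ} (hq : q ≠ 0) (hX : X ≠ 0) (hE₀ : E ≠ 0)
    (hC : 1 - C ≠ 0) (hC' : 1 + C ≠ 0) (hE1 : 1 - E ≠ 0) (hE2 : 1 - E * q ≠ 0)
    (hqX : 1 - q * X ≠ 0) (hqX' : 1 + q * X ≠ 0) (hE : 1 - E * X ≠ 0) (hE' : 1 - E * q * X ≠ 0)
    (hF : 1 - F * X ≠ 0) (hA₀ : A ≠ 0) (hAB : A * B = q) (bal : E * F = q * C ^ 2) :
    1 - (1 - E * A) * (1 - E * B) / ((1 - E) * (1 - E * q)) *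
        ((1 - C * X) / (1 - C) * ((1 + C * X) / (1 + C)) *
          ((1 - E) * (1 - E * q) / ((1 - E * X) * (1 - E * q * X)))) =
      -E / ((1 - C) * (1 + C)) *
        ((q * ((1 - A * X) * (1 - B * X) * (1 - C * X) * (1 + C * X)) /
          ((1 - q * X) * (1 - E * X) * (1 - F * X) * (1 + q * X))) *
          ((1 - q * X) * (1 + q * X) * (1 - F * X) / (q * X * (1 - E * q * X))) -
          (1 - X) * (1 + X) * (1 - F * X / q) / (X * (1 - E * X))) := by
  obtain rfl : F = q * C ^ 2 / E := by
    rw [← bal]; field_simp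
  obtain rfl : B = q / A := by
    rw [← hAB]; field_simp
  have e1 : (q * ((1 - A * X) * (1 - q / A * X) * (1 - C * X) * (1 + C * X)) /
          ((1 - q * X) * (1 - E * X) * (1 - q * C ^ 2 / E * X) * (1 + q * X))) *
          ((1 - q * X) * (1 + q * X) * (1 - q * C ^ 2 / E * X) / (q * X * (1 - E * q * X))) =
      (1 - A * X) * (1 - q / A * X) * (1 - C * X) * (1 + C * X) /
        ((1 - E * X) * (1 - E * q * X) * X) := by
    generalize q * C ^ 2 / E = F at *
    have hF' := hF
    rw [mul_comm] at hF'
    field_simp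
  rw [e1]
  clear e1 hF bal hqX hqX' hAB
  have hE3 := hE2
  rw [mul_comm] at hE3
  have h1 : 1 - q * E * X ≠ 0 := by rwa [mul_comm q]
  have h2 : 1 - E * X * q ≠ 0 := by rwa [mul_right_comm] at hE'
  have h3 : 1 - q * X * E ≠ 0 := by convert hE' using 1; ring
  have h4 : 1 - X * E * q ≠ 0 := by convert hE' using 1; ring
  have h5 : 1 - X * q * E ≠ 0 := by convert hE' using 1; ring
  have h6 : 1 - X * E ≠ 0 := by convert hE using 1; ring
  field_simp
  ring

/-- Three-term contiguous relation between balanced `₄φ₃` series: removing a factor `q` from the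
denominator parameter `F * q` is balanced by removing it from either `A * q` or `B * q`. The
hypothesis `hN` says that all series terminate before `N`. -/
theorem contig_pair {q A B C D E F G : ℂ} (hq : q ≠ 0) (hA₀ : A ≠ 0)
    (hB₀ : B ≠ 0) (hE₀ : E ≠ 0) (hF₀ : F ≠ 0) (hA : 1 - A ≠ 0) (hB : 1 - B ≠ 0) (hAB : A - B ≠ 0)
    (hFC : F - C ≠ 0) (hFD : F - D ≠ 0) (hq1 : ∀ k : ℕ, 1 - q * q ^ k ≠ 0)
    (hE : ∀ k : ℕ, 1 - E * q ^ k ≠ 0) (hF : ∀ k : ℕ, 1 - F * q ^ k ≠ 0)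
    (hG : ∀ k : ℕ, 1 - G * q ^ k ≠ 0) (bal : A * B * C * D * q ^ 2 = E * F * G)
    {N : ℕ} (hN : qPoch C q N = 0) :
    ∑ k ∈ range N, phiTerm q (A * q) (B * q) C D E (F * q) G k =
      F * (1 - F) * (q * B - E) * (q * B - G) / ((F - C) * (F - D) * (q ^ 2 * B * (A - B))) *
        ∑ k ∈ range N, phiTerm q (A * q) B C D E F G k +
      F * (1 - F) * (q * A - E) * (q * A - G) / ((F - C) * (F - D) * (q ^ 2 * A * (B - A))) *
        ∑ k ∈ range N, phiTerm q A (B * q) C D E F G k := by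
  have hF1 : 1 - F ≠ 0 := by simpa using hF 0
  -- `phiTerm` with parameters `A`, `B`, `F` is the common part of the three summands; the shifted
  -- summands are obtained from it by factors linear or linear fractional in `q ^ k`.
  set g : ℕ → ℂ := fun k => F * (1 - F) / ((F - C) * (F - D) * ((1 - A) * (1 - B))) *
    (phiTerm q A B C D E F G k * ((1 - q ^ k) * (1 - E * q ^ k / q) * (1 - G * q ^ k / q) / q ^ k))
    with hg
  have hg0 : g 0 = 0 := by simp [hg]
  have hgN : g N = 0 := by simp [hg, phiTerm, hN]
  have key := Finset.sum_range_sub g N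
  rw [hg0, hgN, sub_zero] at key
  rw [← sub_eq_zero, ← sub_sub, mul_sum, mul_sum, ← sum_sub_distrib, ← sum_sub_distrib, ← key]
  refine sum_congr rfl fun k _ => ?_
  have h1 : phiTerm q (A * q) (B * q) C D E (F * q) G k = phiTerm q A B C D E F G k *
      ((1 - A * q ^ k) / (1 - A) * ((1 - B * q ^ k) / (1 - B)) * ((1 - F) / (1 - F * q ^ k))) := by
    simp only [phiTerm, qPoch_mul_base _ _ _ hA, qPoch_mul_base _ _ _ hB, qPoch_mul_base _ _ _ hF1]
    simp only [div_eq_mul_inv, mul_inv, inv_inv]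
    ring
  have h2 : phiTerm q (A * q) B C D E F G k = phiTerm q A B C D E F G k *
      ((1 - A * q ^ k) / (1 - A)) := by
    simp only [phiTerm, qPoch_mul_base _ _ _ hA]
    simp only [div_eq_mul_inv]
    ring
  have h3 : phiTerm q A (B * q) C D E F G k = phiTerm q A B C D E F G k *
      ((1 - B * q ^ k) / (1 - B)) := by
    simp only [phiTerm, qPoch_mul_base _ _ _ hB]
    simp only [div_eq_mul_inv]
    ring
  rw [hg, h1, h2, h3]
  simp only [phiTerm_succ, pow_succ']
  have hX := pow_ne_zero k hq
  have := contig_pair_rat hq hX hA₀ hB₀ hE₀ hF₀ hA hB hAB hFC hFD (hq1 k) (hE k) (hF k) (hG k) bal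
  rw [show E * (q * q ^ k) / q = E * q ^ k by field_simp,
    show G * (q * q ^ k) / q = G * q ^ k by field_simp]
  linear_combination phiTerm q A B C D E F G k * this

/-- Three-term contiguous relation between balanced `₄φ₃` series: either `D * q` and
`F * q` both lose a factor `q`, or `C` and `E` both gain one. All series terminate before `N`. -/
theorem contig_shift {q A B C D E F G : ℂ} (hq : q ≠ 0)
    (hD₀ : D ≠ 0) (hE₀ : E ≠ 0) (hF₀ : F ≠ 0) (hC : 1 - C ≠ 0) (hD : 1 - D ≠ 0)
    (hFC : F - C ≠ 0) (hFE : E * F - A * B ≠ 0) (hq1 : ∀ k : ℕ, 1 - q * q ^ k ≠ 0)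
    (hE : ∀ k : ℕ, 1 - E * q ^ k ≠ 0) (hF : ∀ k : ℕ, 1 - F * q ^ k ≠ 0)
    (hG : ∀ k : ℕ, 1 - G * q ^ k ≠ 0) (bal : A * B * C * D * q = E * F * G)
    {N : ℕ} (hN : qPoch C q N = 0) :
    ∑ k ∈ range N, phiTerm q A B C (D * q) E (F * q) G k =
      E * F * (1 - F) * (G - q * D) / ((F - C) * (E * F - A * B) * (q * D)) *
        ∑ k ∈ range N, phiTerm q A B C D E F G k +
      -F * (1 - C) * (E - A) * (E - B) / ((F - C) * (E * F - A * B) * (1 - E)) *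
        ∑ k ∈ range N, phiTerm q A B (C * q) (D * q) (E * q) (F * q) G k := by
  have hF1 : 1 - F ≠ 0 := by simpa using hF 0
  have hE1 : 1 - E ≠ 0 := by simpa using hE 0
  set g : ℕ → ℂ := fun k => E * F * (1 - F) / ((F - C) * (E * F - A * B) * (1 - D)) *
    (phiTerm q A B C D E F G k * ((1 - q ^ k) * (1 - G * q ^ k / q) / q ^ k))
    with hg
  have hg0 : g 0 = 0 := by simp [hg]
  have hgN : g N = 0 := by simp [hg, phiTerm, hN]
  have key := Finset.sum_range_sub g N
  rw [hg0, hgN, sub_zero] at key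
  rw [← sub_eq_zero, ← sub_sub, mul_sum, mul_sum, ← sum_sub_distrib, ← sum_sub_distrib, ← key]
  refine sum_congr rfl fun k _ => ?_
  have h1 : phiTerm q A B C (D * q) E (F * q) G k = phiTerm q A B C D E F G k *
      ((1 - D * q ^ k) / (1 - D) * ((1 - F) / (1 - F * q ^ k))) := by
    simp only [phiTerm, qPoch_mul_base _ _ _ hD, qPoch_mul_base _ _ _ hF1]
    simp only [div_eq_mul_inv, mul_inv, inv_inv]
    ring
  have h3 : phiTerm q A B (C * q) (D * q) (E * q) (F * q) G k = phiTerm q A B C D E F G k *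
      ((1 - C * q ^ k) / (1 - C) * ((1 - D * q ^ k) / (1 - D)) * ((1 - E) / (1 - E * q ^ k)) *
            ((1 - F) / (1 - F * q ^ k))) := by
    simp only [phiTerm, qPoch_mul_base _ _ _ hC, qPoch_mul_base _ _ _ hD, qPoch_mul_base _ _ _ hE1,
      qPoch_mul_base _ _ _ hF1]
    simp only [div_eq_mul_inv, mul_inv, inv_inv]
    ring
  rw [hg, h1, h3]
  simp only [phiTerm_succ, pow_succ']
  have hX := pow_ne_zero k hq
  have := contig_shift_rat hq hX hD₀ hE₀ hF₀ hC hD hE1 hFC hF1 hFE (hq1 k) (hE k) (hF k) (hG k) bal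
  rw [show G * (q * q ^ k) / q = G * q ^ k by field_simp]
  linear_combination phiTerm q A B C D E F G k * this

/-- First-order recurrence for the series of Andrews' terminating `q`-analogue of Whipple's
`₃F₂` sum, where `C = q ^ (-n)`. -/
theorem whipple_step {q A B C E F : ℂ} (hq : q ≠ 0) (hA₀ : A ≠ 0) (hE₀ : E ≠ 0)
    (hC : 1 - C ≠ 0) (hC' : 1 + C ≠ 0) (hq1 : ∀ k : ℕ, 1 - q * q ^ k ≠ 0)
    (hq2 : ∀ k : ℕ, 1 + q * q ^ k ≠ 0)
    (hE : ∀ k : ℕ, 1 - E * q ^ k ≠ 0) (hF : ∀ k : ℕ, 1 - F * q ^ k ≠ 0)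
    (hAB : A * B = q) (bal : E * F = q * C ^ 2) {N : ℕ} (hN : qPoch C q N = 0) :
    ∑ k ∈ range N, phiTerm q A B C (-C) E F (-q) k =
      (1 - E * A) * (1 - E * B) / ((1 - E) * (1 - E * q)) *
        ∑ k ∈ range N, phiTerm q A B (C * q) (-(C * q)) (E * q * q) F (-q) k := by
  have hE1 : 1 - E ≠ 0 := by simpa using hE 0
  have hE2 : 1 - E * q ≠ 0 := by simpa using hE 1
  set g : ℕ → ℂ := fun k => -E / ((1 - C) * (1 + C)) *
    (phiTerm q A B C (-C) E F (-q) k *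
      ((1 - q ^ k) * (1 + q ^ k) * (1 - F * q ^ k / q) / (q ^ k * (1 - E * q ^ k)))) with hg
  have hg0 : g 0 = 0 := by simp [hg]
  have hgN : g N = 0 := by simp [hg, phiTerm, hN]
  have key := Finset.sum_range_sub g N
  rw [hg0, hgN, sub_zero] at key
  rw [← sub_eq_zero, mul_sum, ← sum_sub_distrib, ← key]
  refine sum_congr rfl fun k _ => ?_
  have h2 : phiTerm q A B (C * q) (-(C * q)) (E * q * q) F (-q) k =
      phiTerm q A B C (-C) E F (-q) k *
        ((1 - C * q ^ k) / (1 - C) * ((1 + C * q ^ k) / (1 + C)) *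
          ((1 - E) * (1 - E * q) / ((1 - E * q ^ k) * (1 - E * q * q ^ k)))) := by
    have e : -(C * q) = -C * q := by ring
    have hC'' : 1 - -C ≠ 0 := by simpa using hC'
    simp only [phiTerm, e, qPoch_mul_base _ _ _ hC, qPoch_mul_base _ _ _ hC'',
      qPoch_mul_base _ _ _ hE1, qPoch_mul_base _ _ _ hE2]
    simp only [div_eq_mul_inv, mul_inv, inv_inv, sub_neg_eq_add, neg_mul]
    ring
  rw [hg, h2]
  simp only [phiTerm_succ, pow_succ']
  have hX := pow_ne_zero k hq
  have hE3 : 1 - E * q * q ^ k ≠ 0 := by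
    have := hE (k + 1)
    rwa [pow_succ', ← mul_assoc] at this
  have := whipple_rat hq hX hE₀ hC hC' hE1 hE2 (hq1 k) (hq2 k) (hE k) hE3 (hF k) hA₀ hAB bal
  rw [show F * (q * q ^ k) / q = F * q ^ k by field_simp]
  simp only [neg_mul, sub_neg_eq_add, ← mul_assoc] at this ⊢
  linear_combination phiTerm q A B C (-C) E F (-q) k * this

/-! ### Generic parameters and Andrews' sum -/

theorem qPoch_zpow_succ' {q : ℂ} (hq : q ≠ 0) {z w : ℤ} (h : w = z + 1) (n : ℕ) :
    qPoch (q ^ z) q (n + 1) = (1 - q ^ z) * qPoch (q ^ w) q n := by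
  rw [qPoch_succ', h, zpow_add_one₀ hq]

theorem qPoch_zpow_succ {q : ℂ} (hq : q ≠ 0) {z w : ℤ} {n : ℕ} (h : w = z + n) :
    qPoch (q ^ z) q (n + 1) = qPoch (q ^ z) q n * (1 - q ^ w) := by
  rw [qPoch_succ, h, zpow_add₀ hq, zpow_natCast]

theorem qPoch_neg_zpow_eq_zero {q : ℂ} (hq : q ≠ 0) {n N : ℕ} (h : n < N) :
    qPoch (q ^ (-(n : ℤ))) q N = 0 :=
  prod_eq_zero (mem_range.2 h) (by simp [hq])

/-- `q` is nonzero and not a root of unity. -/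
def NotRootOfUnity (q : ℂ) : Prop := q ≠ 0 ∧ ∀ z : ℤ, z ≠ 0 → q ^ z ≠ 1

/-- `x` is nonzero and different from all integer powers of `q`. -/
def AvoidsPowers (q x : ℂ) : Prop := x ≠ 0 ∧ ∀ z : ℤ, x * q ^ z ≠ 1

namespace NotRootOfUnity


theorem one_sub_zpow_ne_zero {q : ℂ} (h : NotRootOfUnity q) {z : ℤ} (hz : z ≠ 0) :
    1 - q ^ z ≠ 0 :=
  sub_ne_zero.2 (h.2 z hz).symm

theorem one_sub_mul_pow_ne_zero {q : ℂ} (h : NotRootOfUnity q) (k : ℕ) : 1 - q * q ^ k ≠ 0 := by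
  have := h.one_sub_zpow_ne_zero (z := (k + 1 : ℕ)) (by lia)
  rwa [zpow_natCast, pow_succ'] at this

theorem one_add_zpow_ne_zero {q : ℂ} (h : NotRootOfUnity q) {z : ℤ} (hz : z ≠ 0) :
    1 + q ^ z ≠ 0 := by
  intro h0
  refine h.2 (z * 2) (by lia) ?_
  rw [zpow_mul, show q ^ z = -1 by linear_combination h0]
  norm_num

theorem one_add_mul_pow_ne_zero {q : ℂ} (h : NotRootOfUnity q) (k : ℕ) : 1 + q * q ^ k ≠ 0 := by
  have := h.one_add_zpow_ne_zero (z := (k + 1 : ℕ)) (by lia)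
  rwa [zpow_natCast, pow_succ'] at this

theorem one_sub_mul_sq_pow_ne_zero {q : ℂ} (h : NotRootOfUnity q) (k : ℕ) :
    1 - q * (q ^ 2) ^ k ≠ 0 := by
  rw [← pow_mul]
  exact h.one_sub_mul_pow_ne_zero _

end NotRootOfUnity

namespace AvoidsPowers


theorem one_sub_ne_zero {q x : ℂ} (h : AvoidsPowers q x) (z : ℤ) : 1 - x * q ^ z ≠ 0 :=
  sub_ne_zero.2 (h.2 z).symm

theorem one_sub_pow_ne_zero {q x : ℂ} (h : AvoidsPowers q x) (k : ℕ) : 1 - x * q ^ k ≠ 0 := by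
  simpa using h.one_sub_ne_zero k

theorem mul_zpow {q x : ℂ} (h : AvoidsPowers q x) (hq : q ≠ 0) (w : ℤ) :
    AvoidsPowers q (x * q ^ w) :=
  ⟨mul_ne_zero h.1 (zpow_ne_zero _ hq), fun z => by
    rw [mul_assoc, ← zpow_add₀ hq]; exact h.2 _⟩

theorem mul_base {q x : ℂ} (h : AvoidsPowers q x) (hq : q ≠ 0) : AvoidsPowers q (x * q) := by
  simpa using h.mul_zpow hq 1

theorem zpow_div {q x : ℂ} (h : AvoidsPowers q x) (hq : q ≠ 0) (w : ℤ) :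
    AvoidsPowers q (q ^ w / x) :=
  ⟨div_ne_zero (zpow_ne_zero _ hq) h.1, fun z hz => h.2 (-w - z) (by
    have := h.1
    have h2 := zpow_ne_zero z hq
    have h3 := zpow_ne_zero w hq
    rw [div_mul_eq_mul_div, div_eq_one_iff_eq this] at hz
    rw [← hz, ← zpow_add₀ hq, ← zpow_add₀ hq]
    simp)⟩

end AvoidsPowers

/-- Andrews' terminating `q`-analogue of Whipple's `₃F₂` sum. -/
theorem sum_phiTerm_whipple {q A B : ℂ} (hq : NotRootOfUnity q) (hAB : A * B = q) (n N : ℕ)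
    (hN : n < N) (c : ℂ) (hc : AvoidsPowers q c) :
    ∑ k ∈ range N, phiTerm q A B (q ^ (-(n : ℤ))) (-q ^ (-(n : ℤ))) c
        (q ^ (1 - 2 * (n : ℤ)) / c) (-q) k =
      qPoch (A * c) (q ^ 2) n * qPoch (B * c) (q ^ 2) n / qPoch c q (2 * n) := by
  have hq0 := hq.1
  have hA₀ : A ≠ 0 := by rintro rfl; simp at hAB; exact hq0 hAB.symm
  induction n generalizing c with
  | zero =>
    obtain ⟨N, rfl⟩ : ∃ M, N = M + 1 := ⟨N - 1, by lia⟩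
    rw [sum_range_succ']
    have : ∀ k : ℕ, qPoch 1 q (k + 1) = 0 := fun k => by simp [qPoch_succ']
    simp [phiTerm, this, qPoch_zero]
  | succ n ih =>
    have e1 : q ^ (-((n + 1 : ℕ) : ℤ)) * q = q ^ (-(n : ℤ)) := by
      rw [← zpow_add_one₀ hq0]; congr 1; push_cast; ring
    have e2 : q ^ (1 - 2 * ((n + 1 : ℕ) : ℤ)) / c = q ^ (1 - 2 * (n : ℤ)) / (c * q * q) := by
      rw [div_eq_div_iff hc.1 (by simp [hq0, hc.1])]
      have : q ^ (1 - 2 * (n : ℤ)) = q ^ (1 - 2 * ((n + 1 : ℕ) : ℤ)) * q ^ (2 : ℤ) := by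
        rw [← zpow_add₀ hq0]; congr 1; push_cast; ring
      rw [this]; norm_cast; ring
    have hz := hq.one_sub_zpow_ne_zero (z := -((n + 1 : ℕ) : ℤ)) (by lia)
    have hz' := hq.one_add_zpow_ne_zero (z := -((n + 1 : ℕ) : ℤ)) (by lia)
    have bal : c * (q ^ (1 - 2 * ((n + 1 : ℕ) : ℤ)) / c) =
        q * (q ^ (-((n + 1 : ℕ) : ℤ))) ^ 2 := by
      rw [mul_div_cancel₀ _ hc.1, sub_eq_add_neg, zpow_add₀ hq0, zpow_one, ← zpow_natCast, ← zpow_mul]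
      congr 2; push_cast; ring
    rw [whipple_step hq0 hA₀ hc.1 hz hz' hq.one_sub_mul_pow_ne_zero hq.one_add_mul_pow_ne_zero
      hc.one_sub_pow_ne_zero (hc.zpow_div hq0 _).one_sub_pow_ne_zero hAB bal
      (qPoch_neg_zpow_eq_zero hq0 hN), e1, e2,
      ih (by lia) _ ((hc.mul_base hq0).mul_base hq0), show 2 * (n + 1) = 2 * n + 1 + 1 by ring,
      qPoch_succ' c, qPoch_succ' (c * q), qPoch_succ' (A * c), qPoch_succ' (B * c),
      div_mul_div_comm]
    congr 1 <;> ring_nf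

/-! ### Expansion over `j`: raising `m` -/

/-- The part of the `j`-th summand that depends on the numerator parameters `A`, `B`, where
`A * B = q`. -/
noncomputable def pairFactor (q A B c : ℂ) (n j : ℕ) : ℂ :=
  qPoch (A * c / q) q j * qPoch (B * c / q) q j *
    (qPoch (A * c * q ^ j) (q ^ 2) (n - j) * qPoch (B * c * q ^ j) (q ^ 2) (n - j))

theorem pairFactor_succ (q A B c : ℂ) (n j : ℕ) :
    pairFactor q A B c (n + 1) (j + 1) =
      (1 - A * c / q) * (1 - B * c / q) * pairFactor q A B (c * q) n j := by
  have e : ∀ x, x * c / q * q = x * (c * q) / q := fun x => by ring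
  have e' : ∀ x, x * c * q ^ (j + 1) = x * (c * q) * q ^ j := fun x => by ring
  simp only [pairFactor, qPoch_succ', e, e', Nat.add_sub_add_right]
  ring

/-- The coefficients of the expansion over `j`. The factor `(c ^ 2; q ^ 2)_n`, which arises as
`(c ^ 2; q ^ 2)_j * (q ^ (2 * j) * c ^ 2; q ^ 2)_(n - j)`, does not depend on `j` and is left to
`shiftPrefactor`, so that the coefficients do not involve `c`. -/
noncomputable def shiftCoeff (q : ℂ) (m n j : ℕ) : ℂ :=
  q ^ (((m : ℤ) - n) * j + ((j + 1).choose 2 : ℕ)) * qPoch (q ^ (-(m : ℤ))) q j *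
      qPoch (q ^ (-2 * (n : ℤ))) (q ^ 2) j /
    (qPoch q q j * qPoch (q ^ ((m : ℤ) - 2 * n)) q j * qPoch (q ^ ((j : ℤ) - 2 * n - 1)) q j *
      qPoch q (q ^ 2) (n - j))

/-- The factor independent of `j` in the expansion over `j`; `(-c; q)_n / (c ^ 2; q ^ 2)_n` has been
simplified to `1 / (c; q)_n`. -/
noncomputable def shiftPrefactor (q c : ℂ) (m n : ℕ) : ℂ :=
  qPoch (q ^ (1 - (m : ℤ) + n)) q n /
    (qPoch (c * q ^ ((n : ℤ) - m)) q n * qPoch (-q) q n * qPoch c q n)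

theorem shiftCoeff_succ_succ_succ {q : ℂ} (hq : q ≠ 0) (m n j : ℕ) :
    shiftCoeff q (m + 1) (n + 1) (j + 1) = shiftCoeff q m n j *
      (q ^ ((m : ℤ) - n + j + 1) * (1 - q ^ (-(m : ℤ) - 1)) * (1 - q ^ (-2 * (n : ℤ) - 2)) /
        ((1 - q ^ (j + 1)) * (1 - q ^ ((m : ℤ) - 1 - 2 * n)) * (1 - q ^ ((j : ℤ) - 2 * n - 2)))) := by
  have h1 : q ^ ((((m + 1 : ℕ) : ℤ) - (n + 1 : ℕ)) * (j + 1 : ℕ) + ((j + 1 + 1).choose 2 : ℕ)) =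
      q ^ (((m : ℤ) - n) * j + ((j + 1).choose 2 : ℕ)) * q ^ ((m : ℤ) - n + j + 1) := by
    rw [← zpow_add₀ hq, Nat.choose_succ_succ' (j + 1) 1, Nat.choose_one_right]
    congr 1; push_cast; ring
  have h2 : qPoch (q ^ (-((m + 1 : ℕ) : ℤ))) q (j + 1) =
      (1 - q ^ (-(m : ℤ) - 1)) * qPoch (q ^ (-(m : ℤ))) q j := by
    rw [← qPoch_zpow_succ' hq (by ring)]; congr 2; push_cast; ring
  have h3 : qPoch (q ^ (-2 * ((n + 1 : ℕ) : ℤ))) (q ^ 2) (j + 1) =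
      (1 - q ^ (-2 * (n : ℤ) - 2)) * qPoch (q ^ (-2 * (n : ℤ))) (q ^ 2) j := by
    rw [qPoch_succ', ← zpow_natCast q 2, ← zpow_add₀ hq]
    congr 3 <;> push_cast <;> ring_nf
  have h4 : qPoch (q ^ (((m + 1 : ℕ) : ℤ) - 2 * (n + 1 : ℕ))) q (j + 1) =
      (1 - q ^ ((m : ℤ) - 1 - 2 * n)) * qPoch (q ^ ((m : ℤ) - 2 * n)) q j := by
    rw [← qPoch_zpow_succ' hq (by ring)]; congr 2; push_cast; ring
  have h5 : qPoch (q ^ (((j + 1 : ℕ) : ℤ) - 2 * (n + 1 : ℕ) - 1)) q (j + 1) =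
      (1 - q ^ ((j : ℤ) - 2 * n - 2)) * qPoch (q ^ ((j : ℤ) - 2 * n - 1)) q j := by
    rw [← qPoch_zpow_succ' hq (by ring)]; congr 2; push_cast; ring
  simp only [shiftCoeff]
  rw [h1, h2, h3, h4, h5, qPoch_succ q, Nat.add_sub_add_right, div_mul_div_comm, pow_succ']
  congr 1 <;> ring

theorem shiftCoeff_succ_succ {q : ℂ} (hq : q ≠ 0) (m n j : ℕ)
    (h0 : 1 - q ^ ((m : ℤ) - 1 - 2 * n + j) ≠ 0) :
    shiftCoeff q m (n + 1) (j + 1) = shiftCoeff q m n j *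
      (q ^ ((m : ℤ) - n) * (1 - q ^ ((j : ℤ) - m)) * (1 - q ^ (-2 * (n : ℤ) - 2)) *
          (1 - q ^ ((m : ℤ) - 1 - 2 * n + j)) /
        ((1 - q ^ (j + 1)) * (1 - q ^ ((m : ℤ) - 2 - 2 * n)) * (1 - q ^ ((m : ℤ) - 1 - 2 * n)) *
          (1 - q ^ ((j : ℤ) - 2 * n - 2)))) := by
  have h1 : q ^ (((m : ℤ) - (n + 1 : ℕ)) * (j + 1 : ℕ) + ((j + 1 + 1).choose 2 : ℕ)) =
      q ^ (((m : ℤ) - n) * j + ((j + 1).choose 2 : ℕ)) * q ^ ((m : ℤ) - n) := by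
    rw [← zpow_add₀ hq, Nat.choose_succ_succ' (j + 1) 1, Nat.choose_one_right]
    congr 1; push_cast; ring
  have h2 : qPoch (q ^ (-(m : ℤ))) q (j + 1) =
      qPoch (q ^ (-(m : ℤ))) q j * (1 - q ^ ((j : ℤ) - m)) :=
    qPoch_zpow_succ hq (by ring)
  have h3 : qPoch (q ^ (-2 * ((n + 1 : ℕ) : ℤ))) (q ^ 2) (j + 1) =
      (1 - q ^ (-2 * (n : ℤ) - 2)) * qPoch (q ^ (-2 * (n : ℤ))) (q ^ 2) j := by
    rw [qPoch_succ', ← zpow_natCast q 2, ← zpow_add₀ hq]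
    congr 3 <;> push_cast <;> ring_nf
  have h4 : qPoch (q ^ ((m : ℤ) - 2 * (n + 1 : ℕ))) q (j + 1) =
      (1 - q ^ ((m : ℤ) - 2 - 2 * n)) * ((1 - q ^ ((m : ℤ) - 1 - 2 * n)) *
        qPoch (q ^ ((m : ℤ) - 2 * n)) q j / (1 - q ^ ((m : ℤ) - 1 - 2 * n + j))) := by
    rw [← qPoch_zpow_succ' hq (z := (m : ℤ) - 1 - 2 * n) (by ring), qPoch_zpow_succ hq (z := (m : ℤ) - 1 - 2 * n) rfl,
      mul_div_cancel_right₀ _ h0, ← qPoch_zpow_succ' hq (by ring)]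
    congr 2; push_cast; ring
  have h5 : qPoch (q ^ (((j + 1 : ℕ) : ℤ) - 2 * (n + 1 : ℕ) - 1)) q (j + 1) =
      (1 - q ^ ((j : ℤ) - 2 * n - 2)) * qPoch (q ^ ((j : ℤ) - 2 * n - 1)) q j := by
    rw [← qPoch_zpow_succ' hq (by ring)]; congr 2; push_cast; ring
  simp only [shiftCoeff]
  rw [h1, h2, h3, h4, h5, qPoch_succ q, Nat.add_sub_add_right, pow_succ' q j]
  simp only [div_eq_mul_inv, mul_inv, inv_inv]
  ring

theorem shiftCoeff_eq_zero {q : ℂ} (hq : q ≠ 0) {m n j : ℕ} (h : m < j) :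
    shiftCoeff q m n j = 0 := by
  simp only [shiftCoeff, qPoch_neg_zpow_eq_zero hq h, mul_zero, zero_mul, zero_div]

/-- Pascal-type recurrence for the coefficients of the expansion over `j`. All three are rational
multiples of `shiftCoeff q m n j`. -/
theorem shiftCoeff_recurrence {q : ℂ} (hq : NotRootOfUnity q) {m n j : ℕ} (hm : m ≤ n)
    (hj : j ≤ m) :
    shiftCoeff q (m + 1) (n + 1) (j + 1) = shiftCoeff q m (n + 1) (j + 1) +
      -q ^ ((n : ℤ) + 2) * (1 - q ^ (-2 * (n : ℤ) - 2)) /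
        ((q ^ ((m : ℤ) - 1 - 2 * n) - q) * (1 - q ^ (1 - (m : ℤ) + 2 * n))) *
        shiftCoeff q m n j := by
  have h1 := hq.one_sub_zpow_ne_zero (z := (m : ℤ) - 1 - 2 * n) (by lia)
  have h2 := hq.one_sub_zpow_ne_zero (z := (m : ℤ) - 1 - 2 * n + j) (by lia)
  rw [shiftCoeff_succ_succ_succ hq.1, shiftCoeff_succ_succ hq.1 m n j h2]
  have h3 := hq.one_sub_zpow_ne_zero (z := (j : ℤ) + 1) (by lia)
  have h4 := hq.one_sub_zpow_ne_zero (z := (j : ℤ) - 2 * n - 2) (by lia)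
  have h5 := hq.one_sub_zpow_ne_zero (z := (m : ℤ) - 2 - 2 * n) (by lia)
  have h6 := hq.one_sub_zpow_ne_zero (z := 1 - (m : ℤ) + 2 * n) (by lia)
  have e7 : q ^ ((m : ℤ) - 1 - 2 * n) - q = -(q * (1 - q ^ ((m : ℤ) - 2 - 2 * n))) := by
    rw [mul_sub, ← zpow_one_add₀ hq.1]
    ring_nf
  rw [e7]
  have hq0 := hq.1
  have d : ∀ k : ℕ, q ^ (2 * (k : ℤ)) = (q ^ k) ^ 2 := fun k => by
    rw [mul_comm, zpow_mul]; norm_cast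
  have d' : q ^ (-2 * (n : ℤ)) = ((q ^ n) ^ 2)⁻¹ := by
    rw [neg_mul, zpow_neg, d]
  have hM := pow_ne_zero m hq0
  have hN := pow_ne_zero n hq0
  have hJ := pow_ne_zero j hq0
  simp only [zpow_add₀ hq0, zpow_sub₀ hq0, zpow_neg, zpow_natCast, d, d', zpow_ofNat,
    pow_succ q j, pow_one] at h1 h2 h3 h4 h5 h6 ⊢
  generalize q ^ m = M at *
  generalize q ^ n = Y at *
  generalize q ^ j = J at *
  generalize shiftCoeff q m n j = v
  have p1 : q * Y ^ 2 - M ≠ 0 := fun h => h1 (by field_simp; linear_combination h)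
  have p3 : 1 - J * q ≠ 0 := h3
  have p4 : q ^ 2 * Y ^ 2 - J ≠ 0 := fun h => h4 (by field_simp; linear_combination h)
  have p5 : q ^ 2 * Y ^ 2 - M ≠ 0 := fun h => h5 (by field_simp; linear_combination h)
  have e1 : 1 - M / q / Y ^ 2 = (q * Y ^ 2 - M) / (q * Y ^ 2) := by field_simp
  have e4 : 1 - J / Y ^ 2 / q ^ 2 = (q ^ 2 * Y ^ 2 - J) / (q ^ 2 * Y ^ 2) := by field_simp
  have e5 : 1 - M / q ^ 2 / Y ^ 2 = (q ^ 2 * Y ^ 2 - M) / (q ^ 2 * Y ^ 2) := by field_simp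
  have e6 : 1 - q / M * Y ^ 2 = -((q * Y ^ 2 - M) / M) := by field_simp; ring
  rw [e1, e4, e5, e6]
  clear e1 e4 e5 e6 h1 h2 h3 h4 h5 h6
  -- The linear factors are kept as atoms while denominators are cleared, and expanded afterwards.
  obtain ⟨P1, r1⟩ : ∃ P, P = q * Y ^ 2 - M := ⟨_, rfl⟩
  obtain ⟨P3, r3⟩ : ∃ P, P = 1 - J * q := ⟨_, rfl⟩
  obtain ⟨P4, r4⟩ : ∃ P, P = q ^ 2 * Y ^ 2 - J := ⟨_, rfl⟩
  obtain ⟨P5, r5⟩ : ∃ P, P = q ^ 2 * Y ^ 2 - M := ⟨_, rfl⟩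
  rw [← r1] at p1
  rw [← r3] at p3
  rw [← r4] at p4
  rw [← r5] at p5
  rw [← r1, ← r3, ← r4, ← r5]
  field_simp
  rw [r3, r4, r5]
  ring

/-- The ratio of the prefactors for `m + 1` and `m` is the first coefficient in `contig_shift`. -/
theorem shiftPrefactor_succ {q c : ℂ} (hq : NotRootOfUnity q) (hc : AvoidsPowers q c) {m n : ℕ}
    (hm : m + 1 ≤ n) :
    shiftPrefactor q c (m + 1) n =
      c * (q ^ (1 + (m : ℤ) - 2 * n) / c) * (1 - q ^ (1 + (m : ℤ) - 2 * n) / c) *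
          (-q - q * -q ^ ((m : ℤ) - n)) /
        ((q ^ (1 + (m : ℤ) - 2 * n) / c - q ^ (-(n : ℤ))) *
          (c * (q ^ (1 + (m : ℤ) - 2 * n) / c) - q) * (q * -q ^ ((m : ℤ) - n))) *
        shiftPrefactor q c m n := by
  have hq0 := hq.1
  have hc0 := hc.1
  have h1 := hq.one_sub_zpow_ne_zero (z := (n : ℤ) - m + n) (by lia)
  have h3 := hc.one_sub_ne_zero ((n : ℤ) - m - 1)
  have h4 : qPoch (q ^ (1 - ((m + 1 : ℕ) : ℤ) + n)) q n =
      (1 - q ^ ((n : ℤ) - m)) * qPoch (q ^ (1 - (m : ℤ) + n)) q n /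
        (1 - q ^ ((n : ℤ) - m + n)) := by
    have e : (1 - ((m + 1 : ℕ) : ℤ) + n) = (n : ℤ) - m := by push_cast; ring
    have e' : q ^ (1 - (m : ℤ) + n) = q ^ ((n : ℤ) - m) * q := by
      rw [← zpow_add_one₀ hq0]; congr 1; ring
    rw [eq_div_iff h1, e, e', qPoch_shift, zpow_add₀ hq0, zpow_natCast]
  have h5 : qPoch (c * q ^ ((n : ℤ) - (m + 1 : ℕ))) q n =
      (1 - c * q ^ ((n : ℤ) - m - 1)) * qPoch (c * q ^ ((n : ℤ) - m)) q n /
        (1 - c * q ^ ((n : ℤ) - m - 1 + n)) := by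
    have e : ((n : ℤ) - (m + 1 : ℕ)) = (n : ℤ) - m - 1 := by push_cast; ring
    have e' : c * q ^ ((n : ℤ) - m) = c * q ^ ((n : ℤ) - m - 1) * q := by
      rw [mul_assoc, ← zpow_add_one₀ hq0]; congr 2; ring
    rw [eq_div_iff (hc.one_sub_ne_zero _), e, e', qPoch_shift, zpow_add₀ hq0, zpow_natCast,
      mul_assoc c]
  have d : ∀ k : ℕ, q ^ (2 * (k : ℤ)) = (q ^ k) ^ 2 := fun k => by
    rw [mul_comm, zpow_mul]; norm_cast
  have hM := pow_ne_zero m hq0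
  have hN := pow_ne_zero n hq0
  rw [shiftPrefactor, shiftPrefactor, h4, h5]
  clear h4 h5
  generalize qPoch (q ^ (1 - (m : ℤ) + n)) q n = u
  generalize qPoch (c * q ^ ((n : ℤ) - m)) q n = v
  generalize qPoch (-q) q n = v'
  generalize qPoch c q n = v''
  simp only [zpow_add₀ hq0, zpow_sub₀ hq0, zpow_neg, zpow_natCast, d, zpow_ofNat, pow_one]
    at h1 h3 ⊢
  generalize q ^ m = M at *
  generalize q ^ n = Y at *
  have p1 : M - Y ^ 2 ≠ 0 := fun h => h1 (by field_simp; linear_combination h)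
  have p3 : M * q - c * Y ≠ 0 := fun h => h3 (by field_simp; linear_combination h)
  have e1 : 1 - Y / M * Y = (M - Y ^ 2) / M := by field_simp
  have e2 : 1 - Y / M = (M - Y) / M := by field_simp
  have e3 : 1 - c * (Y / M / q) = (M * q - c * Y) / (M * q) := by field_simp
  have e4 : 1 - c * (Y / M / q * Y) = (M * q - c * Y ^ 2) / (M * q) := by field_simp
  have e5 : c * (q * M / Y ^ 2 / c) - q = q * (M - Y ^ 2) / Y ^ 2 := by field_simp
  have e6 : q * M / Y ^ 2 / c - Y⁻¹ = (M * q - c * Y) / (Y ^ 2 * c) := by field_simp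
  have e7 : -q - q * -(M / Y) = q * (M - Y) / Y := by field_simp; ring
  have e8 : 1 - q * M / Y ^ 2 / c = - (M * q - c * Y ^ 2) / (Y ^ 2 * c) := by field_simp; ring
  rw [e1, e2, e3, e4, e5, e6, e7, e8]
  simp only [div_eq_mul_inv, mul_inv, inv_inv, inv_neg]
  generalize (M * q - c * Y ^ 2) = p
  field_simp

/-- The second coefficient in `contig_shift` matches the coefficient in `shiftCoeff_recurrence`,
once the factor from `pairFactor_succ` is taken out. -/
theorem shiftPrefactor_succ_succ {q c : ℂ} (hq : NotRootOfUnity q) (hc : AvoidsPowers q c)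
    {m n : ℕ} (hm : m ≤ n) (A B : ℂ) (hAB : A * B = q) :
    -(q ^ (1 + (m : ℤ) - 2 * (n + 1 : ℕ)) / c) * (1 - q ^ (-((n + 1 : ℕ) : ℤ))) *
          (c - A) * (c - B) /
        ((q ^ (1 + (m : ℤ) - 2 * (n + 1 : ℕ)) / c - q ^ (-((n + 1 : ℕ) : ℤ))) *
          (c * (q ^ (1 + (m : ℤ) - 2 * (n + 1 : ℕ)) / c) - A * B) * (1 - c)) *
        shiftPrefactor q (c * q) m n =
      shiftPrefactor q c (m + 1) (n + 1) *
        (-q ^ ((n : ℤ) + 2) * (1 - q ^ (-2 * (n : ℤ) - 2)) /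
          ((q ^ ((m : ℤ) - 1 - 2 * n) - q) * (1 - q ^ (1 - (m : ℤ) + 2 * n)))) *
        ((1 - A * c / q) * (1 - B * c / q)) := by
  have hq0 := hq.1
  have hc0 := hc.1
  have h1 := hq.one_sub_zpow_ne_zero (z := 1 - (m : ℤ) + 2 * n) (by lia)
  have h3 := hc.one_sub_ne_zero ((n : ℤ) - m)
  have h6 := hq.one_sub_zpow_ne_zero (z := (m : ℤ) - 2 - 2 * n) (by lia)
  have h7 := hq.one_add_zpow_ne_zero (z := (n : ℤ) + 1) (by lia)
  have h8 : 1 - c ≠ 0 := by simpa using hc.one_sub_pow_ne_zero 0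
  have d : ∀ k : ℕ, q ^ (2 * (k : ℤ)) = (q ^ k) ^ 2 := fun k => by
    rw [mul_comm, zpow_mul]; norm_cast
  have d' : q ^ (-2 * (n : ℤ)) = ((q ^ n) ^ 2)⁻¹ := by
    rw [neg_mul, zpow_neg, d]
  have h4 : qPoch (q ^ (1 - ((m + 1 : ℕ) : ℤ) + (n + 1 : ℕ))) q (n + 1) =
      qPoch (q ^ (1 - (m : ℤ) + n)) q n * (1 - q ^ (1 - (m : ℤ) + 2 * n)) := by
    have e : (1 - ((m + 1 : ℕ) : ℤ) + (n + 1 : ℕ)) = 1 - (m : ℤ) + n := by push_cast; ring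
    rw [e, qPoch_zpow_succ hq0]
    ring
  have h5 : qPoch (c * q ^ (((n + 1 : ℕ) : ℤ) - (m + 1 : ℕ))) q (n + 1) =
      (1 - c * q ^ ((n : ℤ) - m)) * qPoch (c * q * q ^ ((n : ℤ) - m)) q n := by
    have e : (((n + 1 : ℕ) : ℤ) - (m + 1 : ℕ)) = (n : ℤ) - m := by push_cast; ring
    rw [e, qPoch_succ', mul_right_comm]
  have hM := pow_ne_zero m hq0
  have hN := pow_ne_zero n hq0
  have hcAB : (c - A) * (c - B) = q * ((1 - A * c / q) * (1 - B * c / q)) := by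
    have : (c - A) * (c - B) = c ^ 2 - c * (A + B) + q := by rw [← hAB]; ring
    rw [this]
    field_simp
    linear_combination -c ^ 2 * hAB
  rw [mul_assoc _ (c - A), hcAB, hAB]
  generalize (1 - A * c / q) * (1 - B * c / q) = w
  rw [shiftPrefactor, shiftPrefactor, h4, h5, qPoch_succ (-q), qPoch_succ' c]
  clear h4 h5
  generalize qPoch (q ^ (1 - (m : ℤ) + n)) q n = u
  generalize qPoch (c * q * q ^ ((n : ℤ) - m)) q n = v
  generalize qPoch (-q) q n = v'
  generalize qPoch (c * q) q n = v''
  simp only [zpow_add₀ hq0, zpow_sub₀ hq0, zpow_neg, zpow_natCast, d, d', zpow_ofNat, pow_one,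
    pow_succ q n] at h1 h3 h6 h7 ⊢
  generalize q ^ m = M at *
  generalize q ^ n = Y at *
  have p1 : M - q * Y ^ 2 ≠ 0 := fun h => h1 (by field_simp; linear_combination h)
  have p3 : M - c * Y ≠ 0 := fun h => h3 (by field_simp; linear_combination h)
  have p6 : q ^ 2 * Y ^ 2 - M ≠ 0 := fun h => h6 (by field_simp; linear_combination h)
  have p7 : 1 + Y * q ≠ 0 := h7
  have p7' : 1 - -q * Y ≠ 0 := fun h => p7 (by linear_combination h)
  have e1 : 1 - q / M * Y ^ 2 = (M - q * Y ^ 2) / M := by field_simp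
  have e3 : 1 - c * (Y / M) = (M - c * Y) / M := by field_simp
  have e5 : c * (q * M / (Y * q) ^ 2 / c) - q = -(q ^ 2 * Y ^ 2 - M) / (Y ^ 2 * q) := by
    field_simp; ring
  have e6 : q * M / (Y * q) ^ 2 / c - (Y * q)⁻¹ = (M - c * Y) / (Y ^ 2 * c * q) := by
    field_simp
  have e7 : M / q / Y ^ 2 - q = - (q ^ 2 * Y ^ 2 - M) / (q * Y ^ 2) := by field_simp; ring
  have e8 : 1 - (Y ^ 2)⁻¹ / q ^ 2 = (Y * q - 1) * (1 - -q * Y) / (q ^ 2 * Y ^ 2) := by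
    field_simp; ring
  have e9 : 1 - (Y * q)⁻¹ = (Y * q - 1) / (Y * q) := by field_simp
  rw [e1, e3, e5, e6, e7, e8, e9]
  generalize (Y * q - 1) = p
  generalize 1 - -q * Y = p7'' at *
  simp only [div_eq_mul_inv, mul_inv, inv_inv, inv_neg]
  field_simp

/-- Both sides are `(q; q)_(2 * n) / (q; q)_n`. -/
theorem qPoch_zpow_eq_sq_mul {q : ℂ} (hq : NotRootOfUnity q) (n : ℕ) :
    qPoch (q ^ (n + 1)) q n = qPoch q (q ^ 2) n * qPoch (-q) q n := by
  have h : ∀ n : ℕ, qPoch q q n * qPoch (q ^ (n + 1)) q n = qPoch q q (2 * n) := by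
    intro n
    rw [qPoch, qPoch, qPoch, two_mul, prod_range_add]
    congr 1
    refine prod_congr rfl fun k _ => ?_
    ring
  have h' : ∀ n : ℕ, qPoch q q n * (qPoch q (q ^ 2) n * qPoch (-q) q n) = qPoch q q (2 * n) := by
    intro n
    induction n with
    | zero => simp [qPoch]
    | succ n ih =>
      rw [show 2 * (n + 1) = 2 * n + 1 + 1 by ring]
      simp only [qPoch_succ]
      rw [← ih]
      ring
  exact mul_left_cancel₀ (qPoch_ne_zero hq.one_sub_mul_pow_ne_zero) ((h n).trans (h' n).symm)

theorem qPoch_add (x q : ℂ) (n m : ℕ) :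
    qPoch x q (n + m) = qPoch x q n * qPoch (x * q ^ n) q m := by
  simp only [qPoch, prod_range_add, pow_add, mul_assoc]

/-- Expansion of the balanced series with numerator parameters `q ^ (-n)`, `-q ^ (m - n)` into
products. -/
theorem sum_phiTerm_shift {q A B : ℂ} (hq : NotRootOfUnity q) (hAB : A * B = q) (m n N : ℕ)
    (hm : m ≤ n) (hN : n < N) (c : ℂ) (hc : AvoidsPowers q c) :
    ∑ k ∈ range N, phiTerm q A B (q ^ (-(n : ℤ))) (-q ^ ((m : ℤ) - n)) c
        (q ^ (1 + (m : ℤ) - 2 * n) / c) (-q) k =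
      shiftPrefactor q c m n *
        ∑ j ∈ range (m + 1), shiftCoeff q m n j * pairFactor q A B c n j := by
  have hq0 := hq.1
  induction m generalizing c n with
  | zero =>
    have h1 := sum_phiTerm_whipple hq hAB n N hN c hc
    rw [← zpow_natCast] at *
    simp only [Nat.cast_zero, add_zero, zero_sub, zero_add, sum_range_one] at h1 ⊢
    rw [h1]
    have h2 := qPoch_zpow_eq_sq_mul hq n
    have h3 : qPoch q (q ^ 2) n ≠ 0 := qPoch_ne_zero hq.one_sub_mul_sq_pow_ne_zero
    have h4 : qPoch (-q) q n ≠ 0 := qPoch_ne_zero fun k => by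
      simpa using hq.one_add_mul_pow_ne_zero k
    have e : (1 - ((0 : ℕ) : ℤ) + n) = ((n + 1 : ℕ) : ℤ) := by push_cast; ring
    have e' : ((n : ℤ) - (0 : ℕ)) = (n : ℕ) := by simp
    simp only [shiftPrefactor, shiftCoeff, pairFactor, e, e', zpow_natCast, h2, qPoch_zero,
      two_mul n, qPoch_add c]
    simp
    field_simp
  | succ m ih =>
    obtain ⟨n, rfl⟩ : ∃ k, n = k + 1 := ⟨n - 1, by lia⟩
    have hmn : m ≤ n := by lia
    have e1 : -q ^ (((m + 1 : ℕ) : ℤ) - (n + 1 : ℕ)) = -q ^ ((m : ℤ) - (n + 1 : ℕ)) * q := by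
      rw [neg_mul, ← zpow_add_one₀ hq0]; congr 2; push_cast; ring
    have e2 : q ^ (1 + ((m + 1 : ℕ) : ℤ) - 2 * (n + 1 : ℕ)) / c =
        q ^ (1 + (m : ℤ) - 2 * (n + 1 : ℕ)) / c * q := by
      rw [div_mul_eq_mul_div, ← zpow_add_one₀ hq0]; congr 2; push_cast; ring
    have e3 : -q ^ ((m : ℤ) - (n + 1 : ℕ)) * q = -q ^ ((m : ℤ) - n) := by
      rw [neg_mul, ← zpow_add_one₀ hq0]; congr 2; push_cast; ring
    have e4 : q ^ (1 + (m : ℤ) - 2 * (n + 1 : ℕ)) / c * q =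
        q ^ (1 + (m : ℤ) - 2 * n) / (c * q) := by
      have : q ^ (1 + (m : ℤ) - 2 * n) = q ^ (1 + (m : ℤ) - 2 * (n + 1 : ℕ)) * q ^ 2 := by
        rw [← zpow_natCast, ← zpow_add₀ hq0]; congr 1; push_cast; ring
      rw [this]
      have := hc.1
      field_simp
    have e5 : q ^ (-((n + 1 : ℕ) : ℤ)) * q = q ^ (-(n : ℤ)) := by
      rw [← zpow_add_one₀ hq0]; congr 1; push_cast; ring
    rw [e1, e2, contig_shift hq0 (neg_ne_zero.2 (zpow_ne_zero _ hq0)) hc.1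
      (hc.zpow_div hq0 _).1 (hq.one_sub_zpow_ne_zero (by lia)) ?_ ?_ ?_ hq.one_sub_mul_pow_ne_zero
      hc.one_sub_pow_ne_zero (hc.zpow_div hq0 _).one_sub_pow_ne_zero ?_ ?_
      (qPoch_neg_zpow_eq_zero hq0 hN), e3, e4, e5, ih (n + 1) (by lia) hN c hc,
      ih n hmn (by lia) _ (hc.mul_base hq0)]
    · rw [← mul_assoc _ (shiftPrefactor q c m (n + 1)),
        ← mul_assoc _ (shiftPrefactor q (c * q) m n),
        shiftPrefactor_succ_succ hq hc hmn A B hAB, hAB,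
        ← shiftPrefactor_succ hq hc (m := m) (n := n + 1) (by lia), mul_assoc, mul_assoc,
        ← mul_add]
      congr 1
      rw [sum_range_succ' _ (m + 1), mul_sum, mul_sum]
      -- The sum for `m` may be extended by the vanishing term `j = m + 1`.
      have h0 : ∑ j ∈ range (m + 1), shiftCoeff q m (n + 1) j * pairFactor q A B c (n + 1) j =
          ∑ j ∈ range (m + 1 + 1), shiftCoeff q m (n + 1) j * pairFactor q A B c (n + 1) j := by
        rw [sum_range_succ _ (m + 1), shiftCoeff_eq_zero hq0 (by lia)]
        simp
      rw [h0, sum_range_succ' _ (m + 1), add_right_comm, ← sum_add_distrib]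
      congr 1
      · refine sum_congr rfl fun j hj => ?_
        rw [pairFactor_succ, shiftCoeff_recurrence hq hmn (by simpa [Nat.lt_succ_iff] using hj)]
        ring
      · congr 1
        simp [shiftCoeff, qPoch_zero]
    · have := hq.one_add_zpow_ne_zero (z := (m : ℤ) - (n + 1 : ℕ)) (by lia)
      rwa [sub_neg_eq_add]
    · rw [sub_ne_zero]
      intro h
      refine hc.2 ((n : ℤ) - m) ?_
      have e : q ^ (1 + (m : ℤ) - 2 * (n + 1 : ℕ)) =
          q ^ (-((n + 1 : ℕ) : ℤ)) * (q ^ ((n : ℤ) - m))⁻¹ := by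
        rw [← zpow_neg, ← zpow_add₀ hq0]; congr 1; push_cast; ring
      have h1 := zpow_ne_zero (-((n + 1 : ℕ) : ℤ)) hq0
      have h2 := zpow_ne_zero ((n : ℤ) - m) hq0
      have hc0 := hc.1
      rw [e] at h
      field_simp at h
      rw [mul_comm]
      exact h.symm
    · rw [mul_div_cancel₀ _ hc.1, hAB, sub_ne_zero]
      intro h
      refine hq.2 ((m : ℤ) - 2 * (n + 1 : ℕ)) (by lia) ?_
      rw [add_sub_assoc, zpow_one_add₀ hq0] at h
      exact mul_left_cancel₀ hq0 (h.trans (mul_one q).symm)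
    · intro k
      simpa using hq.one_add_mul_pow_ne_zero k
    · have e : q ^ (1 + (m : ℤ) - 2 * (n + 1 : ℕ)) =
          q * q ^ (-((n + 1 : ℕ) : ℤ)) * q ^ ((m : ℤ) - (n + 1 : ℕ)) := by
        rw [← zpow_one_add₀ hq0, ← zpow_add₀ hq0]; congr 1; push_cast; ring
      rw [mul_div_cancel₀ _ hc.1, hAB, e]
      ring

/-! ### Expansion over `i`: raising `ℓ` -/

/-- The very-well-poised coefficients of the expansion over `i`, with `y = q / a ^ 2`, `u = c / a`
and `w = q ^ 2 / (a * c)`. -/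
noncomputable def poisedCoeff (q c u y w : ℂ) (l i : ℕ) : ℂ :=
  (-1) ^ i / c ^ i * q ^ ((l + 1) * i) * ((1 - y * q ^ (2 * i)) / (1 - y)) *
    (qPoch (q ^ (-(l : ℤ))) q i * qPoch u q i * qPoch y q i /
      (qPoch q q i * qPoch w q i * qPoch (y * q ^ (l + 1)) q i))

theorem poisedCoeff_eq_zero {q : ℂ} (hq : q ≠ 0) (c u y w : ℂ) {l i : ℕ} (h : l < i) :
    poisedCoeff q c u y w l i = 0 := by
  simp only [poisedCoeff, qPoch_neg_zpow_eq_zero hq h, mul_zero, zero_mul, zero_div]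

/-- Pascal-type recurrence for the coefficients of the expansion over `i`. Replacing `a` by `a / q`
turns `(u, y, w)` into `(u * q, y * q ^ 2, w * q)`. -/
theorem poisedCoeff_recurrence {q : ℂ} (hq : NotRootOfUnity q) {y w c u : ℂ} (hc : c ≠ 0)
    (hy : AvoidsPowers q y) (hw : AvoidsPowers q w) (l i : ℕ) :
    poisedCoeff q c u y w (l + 1) (i + 1) = poisedCoeff q c u y w l (i + 1) +
      1 / c * q ^ (l + 1) * (1 - y * q ^ 2) * (1 - u) * (1 - y * q) /
        ((1 - w) * (1 - y * q ^ (l + 2)) * (1 - y * q ^ (l + 1))) *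
        poisedCoeff q c (u * q) (y * q ^ 2) (w * q) l i := by
  have hq0 := hq.1
  have hw0 : 1 - w ≠ 0 := by simpa using hw.one_sub_pow_ne_zero 0
  have n1 : qPoch q q i ≠ 0 := qPoch_ne_zero hq.one_sub_mul_pow_ne_zero
  have n2 : qPoch (w * q) q i ≠ 0 := qPoch_ne_zero (hw.mul_base hq0).one_sub_pow_ne_zero
  have n3 : qPoch (y * q ^ 2 * q ^ (l + 1)) q i ≠ 0 := by
    refine qPoch_ne_zero fun k => ?_
    have := hy.one_sub_pow_ne_zero (2 + (l + 1) + k)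
    rwa [pow_add, pow_add, ← mul_assoc, ← mul_assoc] at this
  have n4 := pow_ne_zero i hc
  have nL := pow_ne_zero l hq0
  have nJ := pow_ne_zero i hq0
  have hy0 : 1 - y ≠ 0 := by simpa using hy.one_sub_pow_ne_zero 0
  have hy1 := hy.one_sub_pow_ne_zero (i + 1)
  have hy2 := hy.one_sub_pow_ne_zero 2
  have hy3 := hy.one_sub_pow_ne_zero (l + 1)
  have hy4 := hy.one_sub_pow_ne_zero (l + 2)
  have hy5 := hy.one_sub_pow_ne_zero (l + 2 + i)
  have hqi := hq.one_sub_mul_pow_ne_zero i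
  have h2 : qPoch (q ^ (-((l + 1 : ℕ) : ℤ))) q (i + 1) =
      (1 - q ^ (-(l : ℤ) - 1)) * qPoch (q ^ (-(l : ℤ))) q i := by
    rw [← qPoch_zpow_succ' hq0 (by ring)]; congr 2; push_cast; ring
  have h3 : qPoch (q ^ (-(l : ℤ))) q (i + 1) =
      qPoch (q ^ (-(l : ℤ))) q i * (1 - q ^ ((i : ℤ) - l)) :=
    qPoch_zpow_succ hq0 (by ring)
  have h4 : qPoch y q (i + 1) = (1 - y) * ((1 - y * q) * qPoch (y * q ^ 2) q i /
      (1 - y * q ^ (i + 1))) := by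
    rw [qPoch_succ']
    congr 1
    rw [eq_div_iff hy1, pow_two, ← mul_assoc, qPoch_shift, mul_assoc, pow_succ']
  have h5 : qPoch (y * q ^ (l + 1 + 1)) q (i + 1) =
      (1 - y * q ^ (l + 2)) * qPoch (y * q ^ 2 * q ^ (l + 1)) q i := by
    rw [qPoch_succ']; congr 2; ring
  have h6 : qPoch (y * q ^ (l + 1)) q (i + 1) = (1 - y * q ^ (l + 1)) *
      ((1 - y * q ^ (l + 2)) * qPoch (y * q ^ 2 * q ^ (l + 1)) q i /
        (1 - y * q ^ (l + 2 + i))) := by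
    rw [qPoch_succ']
    congr 1
    have e : y * q ^ (l + 1) * q = y * q ^ (l + 2) := by ring
    have e' : y * q ^ 2 * q ^ (l + 1) = y * q ^ (l + 2) * q := by ring
    rw [eq_div_iff hy5, e, e', qPoch_shift, mul_assoc, ← pow_add]
  simp only [poisedCoeff]
  rw [h2, h3, h4, h5, h6, qPoch_succ' u, qPoch_succ' w, qPoch_succ q]
  clear h2 h3 h4 h5 h6
  have hy6 : 1 - y * q ^ 2 ≠ 0 := hy2
  have e1 : y * q ^ (2 * (i + 1)) = y * q ^ 2 * q ^ (2 * i) := by ring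
  have e2 : q ^ ((l + 1 + 1) * (i + 1)) = q ^ ((l + 1) * i) * (q ^ l * q ^ i * q ^ 2) := by ring
  have e3 : q ^ ((l + 1) * (i + 1)) = q ^ ((l + 1) * i) * (q ^ l * q) := by ring
  rw [e1, e2, e3, pow_succ (-1 : ℂ), pow_succ c]
  generalize q ^ ((l + 1) * i) = Z
  generalize 1 - y * q ^ 2 * q ^ (2 * i) = Z1
  generalize (-1 : ℂ) ^ i = Z2
  generalize c ^ i = Z3 at *
  generalize qPoch q q i = P1 at *
  generalize qPoch (w * q) q i = P2 at *
  generalize qPoch (y * q ^ 2 * q ^ (l + 1)) q i = P3 at *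
  generalize qPoch (q ^ (-(l : ℤ))) q i = P4
  generalize qPoch (u * q) q i = P5
  generalize qPoch (y * q ^ 2) q i = P6
  simp only [zpow_sub₀ hq0, zpow_neg, zpow_natCast, zpow_one, pow_add, pow_one] at *
  generalize q ^ l = L at *
  generalize q ^ i = J at *
  clear hy hw
  generalize 1 - u = U
  generalize 1 - w = W at *
  generalize 1 - y * q = V
  generalize 1 - y = D0 at *
  generalize r1 : 1 - y * (J * q) = D1 at *
  generalize 1 - y * q ^ 2 = D2 at *
  generalize r3 : 1 - y * (L * q) = D3 at *
  generalize 1 - y * (L * q ^ 2) = D4 at *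
  generalize r5 : 1 - y * (L * q ^ 2 * J) = D5 at *
  generalize r6 : 1 - q * J = D6 at *
  clear hy2 e1 e2 e3
  field_simp
  rw [← r1, ← r3, ← r5, ← r6]
  ring

/-- The part of the prefactor of the expansion over `i` that does not involve `a`. -/
noncomputable def tailPrefactor (q c : ℂ) (l m n : ℕ) : ℂ :=
  qPoch (-c * q ^ (-(l : ℤ))) q n / (qPoch (-q / c) q l * qPoch (c * q ^ ((n : ℤ) - m - l)) q n)

/-- The factor independent of `i` in the expansion over `i`. The entry `q ^ 2 / a ^ 2` is written
`q / a ^ 2 * q` to keep `q / a ^ 2` visible. -/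
noncomputable def pairPrefactor (q a c : ℂ) (l m n : ℕ) : ℂ :=
  qPoch (q ^ 2 / (a * c)) q l * qPoch (-q / a) q l / qPoch (q / a ^ 2 * q) q l *
    tailPrefactor q c l m n

/-- The factor common to both coefficients of `contig_pair`, specialised to the series at hand. -/
noncomputable def contigFactor (q c : ℂ) (l m n : ℕ) : ℂ :=
  q ^ (1 + (l : ℤ) + m - 2 * n) / c * (1 - q ^ (1 + (l : ℤ) + m - 2 * n) / c) /
    ((q ^ (1 + (l : ℤ) + m - 2 * n) / c - q ^ (-(n : ℤ))) *
      (q ^ (1 + (l : ℤ) + m - 2 * n) / c - -q ^ ((m : ℤ) - n)))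

theorem tailPrefactor_succ {q c : ℂ} (hq : q ≠ 0) (hc : AvoidsPowers q c)
    (hc' : AvoidsPowers q (-c)) (l m n : ℕ) :
    tailPrefactor q c (l + 1) m n =
      -(c / q ^ (l + 1)) * contigFactor q c l m n * tailPrefactor q c l m n := by
  have hc0 := hc.1
  have h3 := hc.one_sub_ne_zero ((n : ℤ) - m - l - 1)
  have h4 := hc'.one_sub_ne_zero ((n : ℤ) - l - 1)
  have h5 : qPoch (c * q ^ ((n : ℤ) - m - (l + 1 : ℕ))) q n =
      (1 - c * q ^ ((n : ℤ) - m - l - 1)) * qPoch (c * q ^ ((n : ℤ) - m - l)) q n /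
        (1 - c * q ^ ((n : ℤ) - m - l - 1 + n)) := by
    have e : ((n : ℤ) - m - (l + 1 : ℕ)) = (n : ℤ) - m - l - 1 := by push_cast; ring
    have e' : c * q ^ ((n : ℤ) - m - l) = c * q ^ ((n : ℤ) - m - l - 1) * q := by
      rw [mul_assoc, ← zpow_add_one₀ hq]; congr 2; ring
    rw [eq_div_iff (hc.one_sub_ne_zero _), e, e', qPoch_shift, zpow_add₀ hq, zpow_natCast,
      mul_assoc c]
  have h6 : qPoch (-c * q ^ (-((l + 1 : ℕ) : ℤ))) q n =
      (1 - -c * q ^ (-(l : ℤ) - 1)) * qPoch (-c * q ^ (-(l : ℤ))) q n /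
        (1 - -c * q ^ ((n : ℤ) - l - 1)) := by
    have e : (-((l + 1 : ℕ) : ℤ)) = -(l : ℤ) - 1 := by push_cast; ring
    have e' : -c * q ^ (-(l : ℤ)) = -c * q ^ (-(l : ℤ) - 1) * q := by
      rw [mul_assoc, ← zpow_add_one₀ hq]; congr 2; ring
    have e'' : (n : ℤ) - l - 1 = -(l : ℤ) - 1 + n := by ring
    rw [eq_div_iff h4, e, e', qPoch_shift, e'', zpow_add₀ hq _ (n : ℤ), zpow_natCast,
      mul_assoc (-c)]
  have h7 := hc'.one_sub_ne_zero (-(l : ℤ) - 1)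
  have d : ∀ k : ℕ, q ^ (2 * (k : ℤ)) = (q ^ k) ^ 2 := fun k => by
    rw [mul_comm, zpow_mul]; norm_cast
  have hM := pow_ne_zero m hq
  have hN := pow_ne_zero n hq
  have hL := pow_ne_zero l hq
  rw [tailPrefactor, tailPrefactor, contigFactor, h5, h6, qPoch_succ]
  clear h5 h6
  generalize qPoch (c * q ^ ((n : ℤ) - m - l)) q n = u
  generalize qPoch (-c * q ^ (-(l : ℤ))) q n = v
  generalize qPoch (-q / c) q l = v'
  simp only [zpow_add₀ hq, zpow_sub₀ hq, zpow_neg, zpow_natCast, d, zpow_one, pow_succ q l]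
    at h3 h4 h7 ⊢
  generalize q ^ m = M at *
  generalize q ^ n = Y at *
  generalize q ^ l = L at *
  have p3 : M * L * q - c * Y ≠ 0 := fun h => h3 (by field_simp; linear_combination h)
  have p4 : L * q + c * Y ≠ 0 := fun h => h4 (by field_simp; linear_combination h)
  have p7 : L * q + c ≠ 0 := fun h => h7 (by field_simp; linear_combination h)
  have e3 : 1 - c * (Y / M / L / q) = (M * L * q - c * Y) / (M * L * q) := by field_simp
  have e4 : 1 - c * (Y / M / L / q * Y) = (M * L * q - c * Y ^ 2) / (M * L * q) := by field_simp
  have e5 : 1 - -c * (Y / L / q) = (L * q + c * Y) / (L * q) := by field_simp; ring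
  have e6 : 1 - -c * (L⁻¹ / q) = (L * q + c) / (L * q) := by field_simp; ring
  have e7 : 1 - -q / c * L = (L * q + c) / c := by field_simp; ring
  have e8 : 1 - q * L * M / Y ^ 2 / c = - (M * L * q - c * Y ^ 2) / (Y ^ 2 * c) := by
    field_simp; ring
  have e9 : q * L * M / Y ^ 2 / c - Y⁻¹ = (M * L * q - c * Y) / (Y ^ 2 * c) := by field_simp
  have e10 : q * L * M / Y ^ 2 / c - -(M / Y) = M * (L * q + c * Y) / (Y ^ 2 * c) := by
    field_simp; ring
  rw [e3, e4, e5, e6, e7, e8, e9, e10]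
  generalize M * L * q - c * Y ^ 2 = p
  generalize M * L * q - c * Y = p' at *
  generalize L * q + c * Y = p'' at *
  generalize L * q + c = p''' at *
  simp only [div_eq_mul_inv, mul_inv, inv_inv]
  field_simp

/-- The ratio of the prefactors for `l + 1` and `l` is the first coefficient in `contig_pair`. -/
theorem pairPrefactor_succ {q a c : ℂ} (hq : q ≠ 0) (ha : AvoidsPowers q (q / a ^ 2))
    (hc : AvoidsPowers q c) (hc' : AvoidsPowers q (-c)) (l m n : ℕ) :
    pairPrefactor q a c (l + 1) m n =
      contigFactor q c l m n * ((q * (q ^ (l + 1) / a) - c) * (q * (q ^ (l + 1) / a) - -q) /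
        (q ^ 2 * (q ^ (l + 1) / a) * (a / q - q ^ (l + 1) / a))) *
        pairPrefactor q a c l m n := by
  have hc0 := hc.1
  have ha0 : a ≠ 0 := by rintro rfl; exact ha.1 (by simp)
  have h1 := ha.one_sub_pow_ne_zero (l + 1)
  have hL := pow_ne_zero l hq
  simp only [pairPrefactor]
  rw [tailPrefactor_succ hq hc hc', qPoch_succ, qPoch_succ, qPoch_succ]
  generalize contigFactor q c l m n = K
  generalize tailPrefactor q c l m n = T
  generalize qPoch (q ^ 2 / (a * c)) q l = x1
  generalize qPoch (-q / a) q l = x2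
  generalize qPoch (q / a ^ 2 * q) q l = x3
  simp only [pow_succ q l] at *
  generalize q ^ l = L at *
  have p : a ^ 2 - q ^ 2 * L ≠ 0 := fun h => h1 (by field_simp; linear_combination h)
  have e1 : 1 - q / a ^ 2 * q * L = (a ^ 2 - q ^ 2 * L) / a ^ 2 := by field_simp
  have e2 : a / q - L * q / a = (a ^ 2 - q ^ 2 * L) / (a * q) := by field_simp
  rw [e1, e2]
  generalize a ^ 2 - q ^ 2 * L = p' at *
  simp only [div_eq_mul_inv, mul_inv, inv_inv]
  generalize x3⁻¹ = x3'
  field_simp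
  ring

/-- The second coefficient in `contig_pair` matches the coefficient in `poisedCoeff_recurrence`. -/
theorem pairPrefactor_succ_mul {q a c : ℂ} (hq : q ≠ 0) (ha : AvoidsPowers q (q / a ^ 2))
    (hc : AvoidsPowers q c) (hc' : AvoidsPowers q (-c)) (hac : 1 - q ^ 2 / (a * c) ≠ 0)
    (l m n : ℕ) :
    pairPrefactor q a c (l + 1) m n *
        (1 / c * q ^ (l + 1) * (1 - q / a ^ 2 * q ^ 2) * (1 - c / a) * (1 - q / a ^ 2 * q) /
          ((1 - q ^ 2 / (a * c)) * (1 - q / a ^ 2 * q ^ (l + 2)) *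
            (1 - q / a ^ 2 * q ^ (l + 1)))) =
      contigFactor q c l m n * ((q * (a / q) - c) * (q * (a / q) - -q) /
        (q ^ 2 * (a / q) * (q ^ (l + 1) / a - a / q))) *
        pairPrefactor q (a / q) c l m n := by
  have hc0 := hc.1
  have ha0 : a ≠ 0 := by rintro rfl; exact ha.1 (by simp)
  have h1 := ha.one_sub_pow_ne_zero (l + 1)
  have h2 := ha.one_sub_pow_ne_zero (l + 2)
  have h3 := ha.one_sub_pow_ne_zero 1
  have h4 := ha.one_sub_pow_ne_zero 2
  have hL := pow_ne_zero l hq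
  have e3 : qPoch (q / a ^ 2 * q) q (l + 1) = (1 - q / a ^ 2 * q) * (1 - q / a ^ 2 * q ^ 2) *
      qPoch (q / (a / q) ^ 2 * q) q l / (1 - q / a ^ 2 * q ^ (l + 2)) := by
    rw [eq_div_iff h2]
    have := qPoch_succ (q / a ^ 2 * q) q (l + 1)
    rw [qPoch_succ' _ _ (l + 1), qPoch_succ'] at this
    have e : q / a ^ 2 * q * q * q = q / (a / q) ^ 2 * q := by field_simp
    have e' : q / a ^ 2 * q * q = q / a ^ 2 * q ^ 2 := by ring
    have e'' : q / a ^ 2 * q * q ^ (l + 1) = q / a ^ 2 * q ^ (l + 2) := by ring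
    rw [e, e', e''] at this
    rw [← this]; ring
  have e4 : q ^ 2 / (a * c) * q = q ^ 2 / (a / q * c) := by field_simp
  have e5 : -q / a * q = -q / (a / q) := by field_simp
  simp only [pairPrefactor]
  rw [tailPrefactor_succ hq hc hc', qPoch_succ' (q ^ 2 / (a * c)), qPoch_succ' (-q / a), e3, e4, e5]
  clear e3 e4 e5
  generalize contigFactor q c l m n = K
  generalize tailPrefactor q c l m n = T
  generalize qPoch (q ^ 2 / (a / q * c)) q l = x1
  generalize qPoch (-q / (a / q)) q l = x2
  generalize qPoch (q / (a / q) ^ 2 * q) q l = x3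
  have p : a ^ 2 - q ^ 2 * q ^ l ≠ 0 := fun h => h1 (by field_simp; linear_combination h)
  have e1 : 1 - q / a ^ 2 * q ^ (l + 1) = (a ^ 2 - q ^ 2 * q ^ l) / a ^ 2 := by field_simp; ring
  have e2 : q ^ (l + 1) / a - a / q = -(a ^ 2 - q ^ 2 * q ^ l) / (a * q) := by field_simp; ring
  rw [e1, e2]
  rw [pow_one] at h3
  generalize a ^ 2 - q ^ 2 * q ^ l = p' at *
  generalize 1 - q / a ^ 2 * q ^ (l + 2) = p2 at *
  generalize 1 - q / a ^ 2 * q ^ 2 = p4 at *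
  generalize 1 - q / a ^ 2 * q = p3 at *
  generalize 1 - q ^ 2 / (a * c) = p5 at *
  simp only [div_eq_mul_inv, mul_inv, inv_inv, pow_succ q l]
  generalize x3⁻¹ = x3'
  field_simp

/-- Expansion of the balanced series with numerator parameters `a`, `q ^ (l + 1) / a` into series
whose first two numerator parameters have product `q`. -/
theorem sum_phiTerm_pair {q c : ℂ} (hq : NotRootOfUnity q) (hc : AvoidsPowers q c)
    (hc' : AvoidsPowers q (-c)) {m n N : ℕ} (hN : n < N) (l : ℕ) (a : ℂ)
    (ha : AvoidsPowers q (q / a ^ 2)) (hac : AvoidsPowers q (q ^ 2 / (a * c))) :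
    (∑ k ∈ range N, phiTerm q a (q ^ (l + 1) / a) (q ^ (-(n : ℤ))) (-q ^ ((m : ℤ) - n)) c
        (q ^ (1 + (l : ℤ) + m - 2 * n) / c) (-q) k) * tailPrefactor q c 0 m n =
      pairPrefactor q a c l m n * ∑ i ∈ range (l + 1),
        poisedCoeff q c (c / a) (q / a ^ 2) (q ^ 2 / (a * c)) l i *
          ∑ k ∈ range N, phiTerm q (a / q ^ i) (q ^ (i + 1) / a) (q ^ (-(n : ℤ)))
            (-q ^ ((m : ℤ) - n)) c (q ^ (1 + (m : ℤ) - 2 * n) / c) (-q) k := by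
  have hq0 := hq.1
  induction l generalizing a with
  | zero =>
    have h1 : 1 - q / a ^ 2 ≠ 0 := by simpa using ha.one_sub_pow_ne_zero 0
    simp [pairPrefactor, poisedCoeff, qPoch_zero, div_self h1]
    ring
  | succ l ih =>
    have ha0 : a ≠ 0 := by rintro rfl; exact ha.1 (by simp)
    have hc0 := hc.1
    have e1 : q ^ (l + 1 + 1) / a = q ^ (l + 1) / a * q := by ring
    have e2 : q ^ (1 + ((l + 1 : ℕ) : ℤ) + m - 2 * n) / c =
        q ^ (1 + (l : ℤ) + m - 2 * n) / c * q := by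
      rw [div_mul_eq_mul_div, ← zpow_add_one₀ hq0]; congr 2; push_cast; ring
    have e3 : a / q * q = a := by field_simp
    have e4 : q ^ (l + 1) / a * q = q ^ (l + 1) / (a / q) := by field_simp
    have key := contig_pair (A := a / q) (B := q ^ (l + 1) / a) (C := q ^ (-(n : ℤ)))
      (D := -q ^ ((m : ℤ) - n)) (E := c) (F := q ^ (1 + (l : ℤ) + m - 2 * n) / c) (G := -q)
      hq0 (div_ne_zero ha0 hq0) (div_ne_zero (pow_ne_zero _ hq0) ha0) hc0
      (hc.zpow_div hq0 _).1 ?_ ?_ ?_ ?_ ?_ hq.one_sub_mul_pow_ne_zero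
      hc.one_sub_pow_ne_zero (hc.zpow_div hq0 _).one_sub_pow_ne_zero ?_ ?_
      (qPoch_neg_zpow_eq_zero hq0 hN)
    · have hac0 : 1 - q ^ 2 / (a * c) ≠ 0 := by simpa using hac.one_sub_pow_ne_zero 0
      have ha' : AvoidsPowers q (q / (a / q) ^ 2) := by
        have := ha.mul_zpow hq0 2
        convert this using 1
        norm_cast
        field_simp
      have hac' : AvoidsPowers q (q ^ 2 / (a / q * c)) := by
        have := hac.mul_base hq0
        convert this using 1
        field_simp
      have r (P x y U V : ℂ) : P * x * y / (U * V) = P / U * (x * y / V) := by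
        rw [div_mul_div_comm, mul_assoc]
      rw [r, r, ← contigFactor] at key
      rw [e1, e2]
      nth_rewrite 1 [← e3]
      rw [key, e3, e4, add_mul, mul_assoc _ _ (tailPrefactor q c 0 m n),
        mul_assoc _ _ (tailPrefactor q c 0 m n), ih a ha hac, ih _ ha' hac',
        ← mul_assoc _ (pairPrefactor q a c l m n), ← mul_assoc _ (pairPrefactor q (a / q) c l m n),
        ← pairPrefactor_succ hq0 ha hc hc',
        ← pairPrefactor_succ_mul hq0 ha hc hc' hac0, mul_assoc, mul_assoc, ← mul_add]
      congr 1
      have h0 : ∀ f : ℕ → ℂ, ∑ i ∈ range (l + 1),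
          poisedCoeff q c (c / a) (q / a ^ 2) (q ^ 2 / (a * c)) l i * f i =
          ∑ i ∈ range (l + 1 + 1),
            poisedCoeff q c (c / a) (q / a ^ 2) (q ^ 2 / (a * c)) l i * f i := fun f => by
        rw [sum_range_succ _ (l + 1), poisedCoeff_eq_zero hq0 _ _ _ _ (by lia)]
        simp
      rw [h0, sum_range_succ' _ (l + 1), sum_range_succ' _ (l + 1), add_right_comm, mul_sum,
        ← sum_add_distrib]
      congr 1
      · refine sum_congr rfl fun i _ => ?_
        have f1 : c / (a / q) = c / a * q := by field_simp
        have f2 : q / (a / q) ^ 2 = q / a ^ 2 * q ^ 2 := by field_simp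
        have f3 : q ^ 2 / (a / q * c) = q ^ 2 / (a * c) * q := by field_simp
        have f4 : a / q / q ^ i = a / q ^ (i + 1) := by rw [div_div, pow_succ']
        have f5 : q ^ (i + 1) / (a / q) = q ^ (i + 1 + 1) / a := by
          rw [div_div_eq_mul_div, ← pow_succ]
        rw [poisedCoeff_recurrence hq hc0 ha hac, f1, f2, f3, f4, f5]
        ring
    · intro h
      refine ha.2 1 ?_
      rw [zpow_one]
      have : a = q := by field_simp at h; linear_combination -h
      subst this
      field_simp
    · intro h
      refine ha.2 (2 * l + 1) ?_
      norm_cast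
      have : a = q ^ (l + 1) := by field_simp at h; linear_combination h
      rw [this]
      field_simp
      ring
    · intro h
      refine ha.2 (l + 1) ?_
      norm_cast
      field_simp at h ⊢
      linear_combination -h
    · intro h
      refine hc.2 ((n : ℤ) - 1 - l - m) ?_
      have e : q ^ (1 + (l : ℤ) + m - 2 * n) =
          q ^ (-(n : ℤ)) * (q ^ ((n : ℤ) - 1 - l - m))⁻¹ := by
        rw [← zpow_neg, ← zpow_add₀ hq0]; congr 1; ring
      have h1 := zpow_ne_zero (-(n : ℤ)) hq0
      have h2 := zpow_ne_zero ((n : ℤ) - 1 - l - m) hq0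
      rw [e, sub_eq_zero] at h
      generalize q ^ (-(n : ℤ)) = x at *
      generalize q ^ ((n : ℤ) - 1 - l - m) = y at *
      field_simp at h
      linear_combination -h
    · intro h
      refine hc'.2 ((n : ℤ) - 1 - l) ?_
      have e : q ^ (1 + (l : ℤ) + m - 2 * n) =
          q ^ ((m : ℤ) - n) * (q ^ ((n : ℤ) - 1 - l))⁻¹ := by
        rw [← zpow_neg, ← zpow_add₀ hq0]; congr 1; ring
      have h1 := zpow_ne_zero ((m : ℤ) - n) hq0
      have h2 := zpow_ne_zero ((n : ℤ) - 1 - l) hq0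
      rw [e] at h
      generalize q ^ ((m : ℤ) - n) = x at *
      generalize q ^ ((n : ℤ) - 1 - l) = y at *
      field_simp at h
      have := mul_left_cancel₀ h1 (h.trans (by ring : _ = x * 0))
      linear_combination -this
    · intro k
      simpa using hq.one_add_mul_pow_ne_zero k
    · have e : q ^ (1 + (l : ℤ) + m - 2 * n) =
          q ^ (l + 1) * q ^ (-(n : ℤ)) * q ^ ((m : ℤ) - n) := by
        rw [← zpow_natCast, ← zpow_add₀ hq0, ← zpow_add₀ hq0]; congr 1; push_cast; ring
      rw [e]
      field_simp

/-! ### The identity for generic parameters -/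

/-- The terminating series, summed over the range where its summands can be nonzero. -/
noncomputable def finiteSeries (q a c : ℂ) (l m n : ℕ) : ℂ :=
  ∑ k ∈ range (n + 1), basicHypTerm q q
    [a, q ^ (1 + l) / a, q ^ (-(n : ℤ)), -q ^ ((m : ℤ) - n)]
    [c, q ^ (1 + (l : ℤ) + m - 2 * n) / c, -q] k

/-- The summand of the double sum. -/
noncomputable def doubleSummand (q a c : ℂ) (l m n i j : ℕ) : ℂ :=
  q ^ (((l : ℤ) + 1) * i + ((m : ℤ) - n) * j + ((j + 1).choose 2 : ℕ)) *
    ((-1) ^ i / c ^ i) *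
    ((1 - q ^ (1 + 2 * i) / a ^ 2) / (1 - q / a ^ 2)) *
    qFrac q [q ^ (-(l : ℤ)), c / a, q / a ^ 2]
      [q, q ^ 2 / (a * c), q ^ (2 + (l : ℤ)) / a ^ 2] i *
    qFrac q [q ^ (-(m : ℤ)), q ^ (-(n : ℤ)), -q ^ (-(n : ℤ)),
        q ^ (-(i : ℤ) - 1) * a * c, q ^ i * c / a]
      [q, c, -c, q ^ ((m : ℤ) - 2 * n), q ^ ((j : ℤ) - 2 * n - 1)] j *
    qFrac (q ^ 2) [q ^ ((j : ℤ) - i) * a * c, q ^ (1 + i + j) * c / a]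
      [q, q ^ (2 * j) * c ^ 2] (n - j)

/-- The double-sum side of the identity, prefactors included. -/
noncomputable def doubleSumSide (q a c : ℂ) (l m n : ℕ) : ℂ :=
  qFrac q [q ^ 2 / (a * c), -q / a] [q ^ 2 / a ^ 2, -q / c] l *
  qFrac q [q ^ (1 - (m : ℤ) + n), -q ^ (-(l : ℤ)) * c] [q ^ ((n : ℤ) - m - l) * c, -q] n *
  ∑ i ∈ range (l + 1), ∑ j ∈ range (m + 1), doubleSummand q a c l m n i j

theorem qPoch_mul_neg (x q : ℂ) (n : ℕ) :
    qPoch x q n * qPoch (-x) q n = qPoch (x ^ 2) (q ^ 2) n := by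
  simp only [qPoch, ← prod_mul_distrib]
  refine prod_congr rfl fun k _ => ?_
  ring

theorem doubleSummand_eq {q a c : ℂ} (hq : q ≠ 0) (ha : a ≠ 0) (l m : ℕ) {n i j : ℕ}
    (hj : j ≤ n) :
    doubleSummand q a c l m n i j =
      poisedCoeff q c (c / a) (q / a ^ 2) (q ^ 2 / (a * c)) l i *
        (shiftCoeff q m n j * pairFactor q (a / q ^ i) (q ^ (i + 1) / a) c n j /
          (qPoch c q n * qPoch (-c) q n)) := by
  have e1 : q ^ (((l : ℤ) + 1) * i + ((m : ℤ) - n) * j + ((j + 1).choose 2 : ℕ)) =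
      q ^ ((l + 1) * i) * q ^ (((m : ℤ) - n) * j + ((j + 1).choose 2 : ℕ)) := by
    rw [← zpow_natCast q ((l + 1) * i), ← zpow_add₀ hq]; congr 1; push_cast; ring
  have e2 : q ^ (1 + 2 * i) / a ^ 2 = q / a ^ 2 * q ^ (2 * i) := by ring
  have e3 : q ^ (2 + (l : ℤ)) / a ^ 2 = q / a ^ 2 * q ^ (l + 1) := by
    rw [zpow_add₀ hq, zpow_natCast]; norm_cast; ring
  have e4 : q ^ (-(i : ℤ) - 1) * a * c = a / q ^ i * c / q := by
    rw [zpow_sub₀ hq, zpow_neg, zpow_natCast, zpow_one]; field_simp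
  have e5 : q ^ i * c / a = q ^ (i + 1) / a * c / q := by
    rw [pow_succ]; field_simp
  have e6 : q ^ ((j : ℤ) - i) * a * c = a / q ^ i * c * q ^ j := by
    rw [zpow_sub₀ hq, zpow_natCast, zpow_natCast]; field_simp
  have e7 : q ^ (1 + i + j) * c / a = q ^ (i + 1) / a * c * q ^ j := by ring
  have e8 : qPoch (q ^ (-2 * (n : ℤ))) (q ^ 2) j =
      qPoch (q ^ (-(n : ℤ))) q j * qPoch (-q ^ (-(n : ℤ))) q j := by
    rw [qPoch_mul_neg, ← zpow_natCast (q ^ (-(n : ℤ))) 2, ← zpow_mul]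
    congr 2; push_cast; ring
  have e9 : qPoch c q n * qPoch (-c) q n =
      qPoch c q j * qPoch (-c) q j * qPoch (q ^ (2 * j) * c ^ 2) (q ^ 2) (n - j) := by
    have := qPoch_add (c ^ 2) (q ^ 2) j (n - j)
    rw [Nat.add_sub_cancel' hj, ← pow_mul, mul_comm (c ^ 2) (q ^ (2 * j))] at this
    rw [qPoch_mul_neg, qPoch_mul_neg, this]
  simp only [doubleSummand, poisedCoeff, shiftCoeff, pairFactor, qFrac, List.map_cons, List.map_nil,
    List.prod_cons, List.prod_nil, mul_one]
  rw [e1, e2, e3, e4, e5, e6, e7, e8, e9]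
  simp only [div_eq_mul_inv, mul_inv]
  ring

theorem finiteSeries_eq_of_generic {q a c : ℂ} (hq : NotRootOfUnity q) (hc : AvoidsPowers q c)
    (hc' : AvoidsPowers q (-c)) (ha : AvoidsPowers q (q / a ^ 2))
    (hac : AvoidsPowers q (q ^ 2 / (a * c))) (l : ℕ) {m n : ℕ} (hmn : m ≤ n) :
    finiteSeries q a c l m n = doubleSumSide q a c l m n := by
  have hq0 := hq.1
  have ha0 : a ≠ 0 := by rintro rfl; exact ha.1 (by simp)
  have key := sum_phiTerm_pair hq hc hc' (m := m) (Nat.lt_succ_self n) l a ha hac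
  have hAB : ∀ i : ℕ, a / q ^ i * (q ^ (i + 1) / a) = q := fun i => by
    have := pow_ne_zero i hq0
    rw [pow_succ]; field_simp
  simp only [sum_phiTerm_shift hq (hAB _) m n _ hmn (Nat.lt_succ_self n) c hc] at key
  have n1 : qPoch c q n ≠ 0 := qPoch_ne_zero hc.one_sub_pow_ne_zero
  have n2 : qPoch (-c) q n ≠ 0 := qPoch_ne_zero hc'.one_sub_pow_ne_zero
  have n3 : qPoch (c * q ^ ((n : ℤ) - m)) q n ≠ 0 :=
    qPoch_ne_zero (hc.mul_zpow hq0 _).one_sub_pow_ne_zero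
  have ht : tailPrefactor q c 0 m n = qPoch (-c) q n / qPoch (c * q ^ ((n : ℤ) - m)) q n := by
    simp [tailPrefactor, qPoch_zero]
  have hL : finiteSeries q a c l m n = ∑ k ∈ range (n + 1), phiTerm q a (q ^ (l + 1) / a)
      (q ^ (-(n : ℤ))) (-q ^ ((m : ℤ) - n)) c (q ^ (1 + (l : ℤ) + m - 2 * n) / c) (-q) k := by
    refine sum_congr rfl fun k _ => ?_
    simp only [basicHypTerm, qFrac, phiTerm, List.map_cons, List.map_nil,
      List.prod_cons, List.prod_nil, mul_one, add_comm 1 l, mul_assoc]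
  have hS : ∑ i ∈ range (l + 1), ∑ j ∈ range (m + 1), doubleSummand q a c l m n i j =
      (∑ i ∈ range (l + 1), poisedCoeff q c (c / a) (q / a ^ 2) (q ^ 2 / (a * c)) l i *
        ∑ j ∈ range (m + 1),
          shiftCoeff q m n j * pairFactor q (a / q ^ i) (q ^ (i + 1) / a) c n j) /
        (qPoch c q n * qPoch (-c) q n) := by
    rw [sum_div]
    refine sum_congr rfl fun i _ => ?_
    rw [mul_div_assoc, sum_div, mul_sum]
    refine sum_congr rfl fun j hj => ?_
    exact doubleSummand_eq hq0 ha0 l m (by have := mem_range.1 hj; lia)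
  simp only [mul_left_comm _ (shiftPrefactor q c m n), ← mul_sum] at key
  rw [doubleSumSide, hS]
  rw [← hL, ht, pairPrefactor, shiftPrefactor, tailPrefactor] at key
  simp only [qFrac, List.map_cons, List.map_nil, List.prod_cons, List.prod_nil, mul_one]
  generalize (∑ i ∈ range (l + 1), poisedCoeff q c (c / a) (q / a ^ 2) (q ^ 2 / (a * c)) l i *
        ∑ j ∈ range (m + 1),
          shiftCoeff q m n j * pairFactor q (a / q ^ i) (q ^ (i + 1) / a) c n j) = S at *
  have f1 : q / a ^ 2 * q = q ^ 2 / a ^ 2 := by ring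
  have f2 : -q ^ (-(l : ℤ)) * c = -c * q ^ (-(l : ℤ)) := by ring
  have f3 : q ^ ((n : ℤ) - m - l) * c = c * q ^ ((n : ℤ) - m - l) := mul_comm _ _
  rw [f1] at key
  rw [f2, f3]
  generalize qPoch (c * q ^ ((n : ℤ) - m)) q n = x1 at *
  generalize qPoch (-c) q n = x2 at *
  generalize qPoch c q n = x3 at *
  refine mul_right_cancel₀ (div_ne_zero n2 n3) (key.trans ?_)
  have hcancel : S / (x3 * x2) * (x2 / x1) = S / (x3 * x1) := by field_simp
  rw [mul_assoc _ (S / (x3 * x2)), hcancel]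
  simp only [div_eq_mul_inv, mul_inv]
  ring

/-! ### Extension by continuity -/

@[fun_prop]
theorem ContinuousAt.qPoch {X : Type*} [TopologicalSpace X] {f g : X → ℂ} {x : X}
    (hf : ContinuousAt f x) (hg : ContinuousAt g x) (n : ℕ) :
    ContinuousAt (fun p => qPoch (f p) (g p) n) x := by
  unfold _root_.qPoch
  fun_prop

theorem countable_setOf_pow_eq {k : ℕ} (hk : 0 < k) (w : ℂ) : {x : ℂ | x ^ k = w}.Countable :=
  ((Polynomial.nthRoots k w).toFinset.finite_toSet.subset fun x hx => by
    simpa [Polynomial.mem_nthRoots hk] using hx).countable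

theorem countable_not_notRootOfUnity : {q : ℂ | ¬ NotRootOfUnity q}.Countable := by
  have : {q : ℂ | ¬ NotRootOfUnity q} ⊆ {0} ∪ ⋃ k : ℕ, {q : ℂ | q ^ (k + 1) = 1} := by
    intro q hq
    by_contra h
    simp only [Set.singleton_union, Set.mem_insert_iff, Set.mem_iUnion, Set.mem_ofPred_eq,
      not_or, not_exists] at h
    refine hq ⟨h.1, fun z hz h1 => h.2 (z.natAbs - 1) ?_⟩
    rw [Nat.sub_add_cancel (by lia)]
    rcases Int.natAbs_eq z with h2 | h2
    · rwa [h2, zpow_natCast] at h1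
    · rwa [h2, zpow_neg, zpow_natCast, inv_eq_one] at h1
  exact ((Set.countable_singleton _).union
    (Set.countable_iUnion fun k => countable_setOf_pow_eq k.succ_pos 1)).mono this

theorem countable_not_avoidsPowers (q : ℂ) :
    {x : ℂ | ¬ AvoidsPowers q x}.Countable := by
  have : {x : ℂ | ¬ AvoidsPowers q x} ⊆ {0} ∪ Set.range fun z : ℤ => q ^ z := by
    intro x hx
    by_contra h
    simp only [Set.singleton_union, Set.mem_insert_iff, Set.mem_range, not_or, not_exists] at h
    refine hx ⟨h.1, fun z hz => h.2 (-z) ?_⟩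
    rw [zpow_neg]
    exact (eq_inv_of_mul_eq_one_left hz).symm
  exact ((Set.countable_singleton _).union (Set.countable_range _)).mono this

/-- The triples `(q, a, c)` for which every factor that the inductions divide by is nonzero. -/
def genericSet : Set (ℂ × ℂ × ℂ) :=
  {p | NotRootOfUnity p.1 ∧ (AvoidsPowers p.1 p.2.2 ∧ AvoidsPowers p.1 (-p.2.2)) ∧
    AvoidsPowers p.1 (p.1 / p.2.1 ^ 2) ∧ AvoidsPowers p.1 (p.1 ^ 2 / (p.2.1 * p.2.2))}

/-- Each condition excludes countably many values of one parameter once the preceding ones are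
fixed, in the order `q`, `c`, `a`. -/
theorem dense_genericSet : Dense genericSet := by
  rintro ⟨q₀, a₀, c₀⟩
  rw [mem_closure_iff_nhds]
  intro t ht
  obtain ⟨u, hu, v, hv, huv⟩ := mem_nhds_prod_iff.1 ht
  obtain ⟨v₁, hv₁, v₂, hv₂, hv₁₂⟩ := mem_nhds_prod_iff.1 hv
  have key : ∀ {s : Set ℂ} {x : ℂ} {w : Set ℂ}, s.Countable → w ∈ 𝓝 x → ∃ y ∈ w, y ∉ s := by
    intro s x w hs hw
    obtain ⟨y, hy⟩ := mem_closure_iff_nhds.1 (hs.dense_compl ℂ x) w hw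
    exact ⟨y, hy.1, hy.2⟩
  obtain ⟨q, hqu, hq⟩ := key countable_not_notRootOfUnity hu
  simp only [Set.mem_ofPred_eq, not_not] at hq
  have hq0 := hq.1
  have hneg : {c : ℂ | ¬ AvoidsPowers q (-c)}.Countable :=
    (countable_not_avoidsPowers q).preimage neg_injective
  obtain ⟨c, hcv, hc⟩ := key ((countable_not_avoidsPowers q).union hneg) hv₂
  simp only [Set.mem_union, Set.mem_ofPred_eq, not_or, not_not] at hc
  have hmul : {a : ℂ | ¬ AvoidsPowers q (a * c)}.Countable :=
    (countable_not_avoidsPowers q).preimage (mul_left_injective₀ hc.1.1)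
  have hsq : {a : ℂ | ¬ AvoidsPowers q (a ^ 2)}.Countable :=
    ((countable_not_avoidsPowers q).biUnion fun w _ =>
      countable_setOf_pow_eq two_pos w).mono fun a ha => by
        simpa using ha
  obtain ⟨a, hav, ha⟩ := key (hsq.union hmul) hv₁
  simp only [Set.mem_union, Set.mem_ofPred_eq, not_or, not_not] at ha
  refine ⟨(q, a, c), huv ⟨hqu, hv₁₂ ⟨hav, hcv⟩⟩, hq, hc, ?_, ?_⟩
  · simpa using ha.1.zpow_div hq0 1
  · simpa using ha.2.zpow_div hq0 2

theorem qPoch_ne_zero_of_le {x q : ℂ} {k n : ℕ} (hk : k ≤ n) (h : qPoch x q n ≠ 0) :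
    qPoch x q k ≠ 0 := by
  rw [← Nat.add_sub_cancel' hk, qPoch_add] at h
  exact left_ne_zero_of_mul h

theorem continuousAt_finiteSeries {q a c : ℂ} {l m n : ℕ}
    (hq : q ≠ 0) (ha : a ≠ 0) (hc : c ≠ 0) (hL₁ : qPoch q q n ≠ 0) (hL₂ : qPoch c q n ≠ 0)
    (hL₃ : qPoch (q ^ (1 + (l : ℤ) + m - 2 * n) / c) q n ≠ 0) (hL₄ : qPoch (-q) q n ≠ 0) :
    ContinuousAt (fun p : ℂ × ℂ × ℂ => finiteSeries p.1 p.2.1 p.2.2 l m n) (q, a, c) := by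
  simp only [finiteSeries, basicHypTerm, qFrac, List.map_cons, List.map_nil,
    List.prod_cons, List.prod_nil, mul_one]
  refine tendsto_finsetSum _ fun k hk => ?_
  have hk' : k ≤ n := by have := mem_range.1 hk; lia
  have := qPoch_ne_zero_of_le hk' hL₁
  have := qPoch_ne_zero_of_le hk' hL₂
  have := qPoch_ne_zero_of_le hk' hL₃
  have := qPoch_ne_zero_of_le hk' hL₄
  refine ContinuousAt.mul (ContinuousAt.div₀ ?_ ?_ ?_) (continuousAt_fst.pow k)
  · fun_prop (disch := first | assumption | exact Or.inl hq)
  · fun_prop (disch := first | assumption | exact Or.inl hq)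
  · simp [*]

theorem continuousAt_doubleSumSide {q a c : ℂ} {l m n : ℕ} (hmn : m ≤ n)
    (hq : q ≠ 0) (ha : a ≠ 0) (hc : c ≠ 0)
    (hL₁ : qPoch q q n ≠ 0) (hL₂ : qPoch c q n ≠ 0) (hL₄ : qPoch (-q) q n ≠ 0)
    (hP₁ : qPoch (q ^ 2 / a ^ 2) q l ≠ 0) (hP₂ : qPoch (-q / c) q l ≠ 0)
    (hP₃ : qPoch (q ^ ((n : ℤ) - m - l) * c) q n ≠ 0)
    (hS₀ : 1 - q / a ^ 2 ≠ 0)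
    (hS₁ : ∀ i ≤ l, qPoch q q i ≠ 0 ∧ qPoch (q ^ 2 / (a * c)) q i ≠ 0 ∧
      qPoch (q ^ (2 + (l : ℤ)) / a ^ 2) q i ≠ 0)
    (hS₂ : ∀ j ≤ m, qPoch (-c) q j ≠ 0 ∧ qPoch (q ^ ((m : ℤ) - 2 * n)) q j ≠ 0 ∧
      qPoch (q ^ ((j : ℤ) - 2 * n - 1)) q j ≠ 0)
    (hS₃ : ∀ j ≤ m, qPoch q (q ^ 2) (n - j) ≠ 0 ∧
      qPoch (q ^ (2 * j) * c ^ 2) (q ^ 2) (n - j) ≠ 0) :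
    ContinuousAt (fun p : ℂ × ℂ × ℂ => doubleSumSide p.1 p.2.1 p.2.2 l m n) (q, a, c) := by
  simp only [doubleSumSide, doubleSummand, qFrac, List.map_cons, List.map_nil,
    List.prod_cons, List.prod_nil, mul_one]
  have hq2 : a ^ 2 ≠ 0 := pow_ne_zero 2 ha
  have hac : a * c ≠ 0 := mul_ne_zero ha hc
  refine ContinuousAt.mul (ContinuousAt.mul (ContinuousAt.div₀ ?_ ?_ ?_)
    (ContinuousAt.div₀ ?_ ?_ ?_)) ?_
  · fun_prop (disch := first | assumption | exact Or.inl hq)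
  · fun_prop (disch := first | assumption | exact Or.inl hq)
  · exact mul_ne_zero hP₁ hP₂
  · fun_prop (disch := first | assumption | exact Or.inl hq)
  · fun_prop (disch := first | assumption | exact Or.inl hq)
  · exact mul_ne_zero hP₃ hL₄
  refine tendsto_finsetSum _ fun i hi => tendsto_finsetSum _ fun j hj => ?_
  have hi' : i ≤ l := by have := mem_range.1 hi; lia
  have hj' : j ≤ m := by have := mem_range.1 hj; lia
  obtain ⟨s1, s2, s3⟩ := hS₁ i hi'
  obtain ⟨s4, s5, s6⟩ := hS₂ j hj'
  obtain ⟨s7, s8⟩ := hS₃ j hj'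
  have s9 := qPoch_ne_zero_of_le (hj'.trans hmn) hL₁
  have s10 := qPoch_ne_zero_of_le (hj'.trans hmn) hL₂
  have hci := pow_ne_zero i hc
  have d1 := mul_ne_zero s1 (mul_ne_zero s2 s3)
  have d2 := mul_ne_zero s9 (mul_ne_zero s10 (mul_ne_zero s4 (mul_ne_zero s5 s6)))
  have d3 := mul_ne_zero s7 s8
  refine ContinuousAt.mul (ContinuousAt.mul (ContinuousAt.mul ?_ (ContinuousAt.div₀ ?_ ?_ d1))
    (ContinuousAt.div₀ ?_ ?_ d2)) (ContinuousAt.div₀ ?_ ?_ d3)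
  · fun_prop (disch := first | assumption | exact Or.inl hq)
  · fun_prop (disch := first | assumption | exact Or.inl hq)
  · fun_prop (disch := first | assumption | exact Or.inl hq)
  · fun_prop (disch := first | assumption | exact Or.inl hq)
  · fun_prop (disch := first | assumption | exact Or.inl hq)
  · fun_prop (disch := first | assumption | exact Or.inl hq)
  · fun_prop (disch := first | assumption | exact Or.inl hq)

theorem theorem13 (q a c : ℂ) (ℓ m n : ℕ) (hmn : m ≤ n)
    (hq : q ≠ 0) (ha : a ≠ 0) (hc : c ≠ 0)
    -- the denominators of the series on the left, up to the index where it terminates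
    (hL₁ : qPoch q q n ≠ 0) (hL₂ : qPoch c q n ≠ 0)
    (hL₃ : qPoch (q ^ (1 + (ℓ : ℤ) + m - 2 * n) / c) q n ≠ 0) (hL₄ : qPoch (-q) q n ≠ 0)
    -- the denominators of the prefactor on the right
    (hP₁ : qPoch (q ^ 2 / a ^ 2) q ℓ ≠ 0) (hP₂ : qPoch (-q / c) q ℓ ≠ 0)
    (hP₃ : qPoch (q ^ ((n : ℤ) - m - ℓ) * c) q n ≠ 0)
    -- the denominators of the double sum
    (hS₀ : 1 - q / a ^ 2 ≠ 0)
    (hS₁ : ∀ i ≤ ℓ, qPoch q q i ≠ 0 ∧ qPoch (q ^ 2 / (a * c)) q i ≠ 0 ∧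
      qPoch (q ^ (2 + (ℓ : ℤ)) / a ^ 2) q i ≠ 0)
    (hS₂ : ∀ j ≤ m, qPoch (-c) q j ≠ 0 ∧ qPoch (q ^ ((m : ℤ) - 2 * n)) q j ≠ 0 ∧
      qPoch (q ^ ((j : ℤ) - 2 * n - 1)) q j ≠ 0)
    (hS₃ : ∀ j ≤ m, qPoch q (q ^ 2) (n - j) ≠ 0 ∧
      qPoch (q ^ (2 * j) * c ^ 2) (q ^ 2) (n - j) ≠ 0) :
    Summable (basicHypTerm q q
      [a, q ^ (1 + ℓ) / a, q ^ (-(n : ℤ)), -q ^ ((m : ℤ) - n)]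
      [c, q ^ (1 + (ℓ : ℤ) + m - 2 * n) / c, -q]) ∧
    basicHyp q q
      [a, q ^ (1 + ℓ) / a, q ^ (-(n : ℤ)), -q ^ ((m : ℤ) - n)]
      [c, q ^ (1 + (ℓ : ℤ) + m - 2 * n) / c, -q] =
    qFrac q [q ^ 2 / (a * c), -q / a] [q ^ 2 / a ^ 2, -q / c] ℓ *
    qFrac q [q ^ (1 - (m : ℤ) + n), -q ^ (-(ℓ : ℤ)) * c] [q ^ ((n : ℤ) - m - ℓ) * c, -q] n *
    ∑ i ∈ Finset.range (ℓ + 1), ∑ j ∈ Finset.range (m + 1),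
      q ^ (((ℓ : ℤ) + 1) * i + ((m : ℤ) - n) * j + ((j + 1).choose 2 : ℕ)) *
      ((-1) ^ i / c ^ i) *
      ((1 - q ^ (1 + 2 * i) / a ^ 2) / (1 - q / a ^ 2)) *
      qFrac q [q ^ (-(ℓ : ℤ)), c / a, q / a ^ 2]
        [q, q ^ 2 / (a * c), q ^ (2 + (ℓ : ℤ)) / a ^ 2] i *
      qFrac q [q ^ (-(m : ℤ)), q ^ (-(n : ℤ)), -q ^ (-(n : ℤ)),
          q ^ (-(i : ℤ) - 1) * a * c, q ^ i * c / a]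
        [q, c, -c, q ^ ((m : ℤ) - 2 * n), q ^ ((j : ℤ) - 2 * n - 1)] j *
      qFrac (q ^ 2) [q ^ ((j : ℤ) - i) * a * c, q ^ (1 + i + j) * c / a]
        [q, q ^ (2 * j) * c ^ 2] (n - j) := by
  have hzero : ∀ k ∉ range (n + 1), basicHypTerm q q
      [a, q ^ (1 + ℓ) / a, q ^ (-(n : ℤ)), -q ^ ((m : ℤ) - n)]
      [c, q ^ (1 + (ℓ : ℤ) + m - 2 * n) / c, -q] k = 0 := by
    intro k hk
    simp only [basicHypTerm, qFrac, List.map_cons, List.prod_cons,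
      qPoch_neg_zpow_eq_zero hq (show n < k by simpa using hk), mul_zero, zero_mul, zero_div]
  refine ⟨summable_of_ne_finset_zero hzero, ?_⟩
  rw [basicHyp, tsum_eq_sum hzero]
  change finiteSeries q a c ℓ m n = doubleSumSide q a c ℓ m n
  have hLc : ContinuousAt (fun p : ℂ × ℂ × ℂ => finiteSeries p.1 p.2.1 p.2.2 ℓ m n) (q, a, c) :=
    continuousAt_finiteSeries hq ha hc hL₁ hL₂ hL₃ hL₄
  have hRc : ContinuousAt (fun p : ℂ × ℂ × ℂ => doubleSumSide p.1 p.2.1 p.2.2 ℓ m n) (q, a, c) :=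
    continuousAt_doubleSumSide hmn hq ha hc hL₁ hL₂ hL₄ hP₁ hP₂ hP₃ hS₀ hS₁ hS₂ hS₃
  have hev : ∀ p ∈ genericSet,
      finiteSeries p.1 p.2.1 p.2.2 ℓ m n = doubleSumSide p.1 p.2.1 p.2.2 ℓ m n := fun p hp =>
    finiteSeries_eq_of_generic hp.1 hp.2.1.1 hp.2.1.2 hp.2.2.1 hp.2.2.2 ℓ hmn
  have hne : (𝓝[genericSet] (q, a, c)).NeBot :=
    mem_closure_iff_nhdsWithin_neBot.1 (dense_genericSet (q, a, c))
  exact tendsto_nhds_unique (hLc.mono_left nhdsWithin_le_nhds)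
    ((hRc.mono_left nhdsWithin_le_nhds).congr'
      (eventually_nhdsWithin_of_forall fun p hp => (hev p hp).symm))
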